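/- For integers $m,n\ge 0$ let $\Lambda^0_{m,n}=\{0,\dots,m\}\times\{0,\dots,n\}$. An \emph{edge} is a straight segment joining two distinct points of $\Lambda^0_{m,n}$ and passing through no other point of $\Lambda^0_{m,n}$; two different edges \emph{cross} if their relative interiors meet. A \emph{triangulation} of $\Lambda^0_{m,n}$ is a maximal set of pairwise non-crossing edges. The midpoints of the edges of any triangulation are exactly the points of $\Lambda_{m,n}=\bigl(\{0,\tfrac12,1,\dots,m\}\times\{0,\tfrac12,1,\dots,n\}\bigr)\setminus\Lambda^0_{m,n}$, each point being the midpoint of exactly one edge. A \emph{set of constraints} is any set $\eta$ of pairwise non-crossing edges; let $\Delta\subseteq\Lambda_{m,n}$ be the set of their midpoints, and let $\Omega(\eta,\Delta)$ be the (finite, nonempty) set of triangulations containing $\eta$. For $\lambda>0$ let $\mu(\sigma)=\lambda^{|\sigma|}/Z$ on $\Omega(\eta,\Delta)$, where $|\sigma|$ is the total $\ell_1$-length of the edges of $\sigma$ and $Z=\sum_{\sigma\in\Omega(\eta,\Delta)}\lambda^{|\sigma|}$. The \emph{heat-bath Glauber dynamics} is the Markov chain on $\Omega(\eta,\Delta)$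 that, in state $\sigma$, picks $x\in\Lambda_{m,n}\setminus\Delta$ uniformly at random; if the edge of $\sigma$ with midpoint $x$ is a diagonal of a convex quadrilateral formed by two triangles of $\sigma$, so that replacing it by the other diagonal gives a triangulation $\sigma'$, then the chain moves to $\sigma'$ with probability $\mu(\sigma')/(\mu(\sigma')+\mu(\sigma))$; otherwise it does nothing (if $\Delta=\Lambda_{m,n}$ the chain stays at its only state). Let $p^t(\sigma,\cdot)$ be its law after $t$ steps from $\sigma$, and let $$T_{\rm mix}=\inf\Bigl\{t\in\mathbb N:\ \max_{\sigma\in\Omega(\eta,\Delta)}\tfrac12\sum_{\tau\in\Omega(\eta,\Delta)}\bigl|p^t(\sigma,\tau)-\mu(\tau)\bigr|\le\tfrac14\Bigr\},\qquad \mathbb N=\{0,1,2,\dots\}.$$ \textbf{Theorem.} There exist constants $C>0$ and $\lambda_0\in(0,1)$, and one may take $\lambda_0=1/8$, such that for all $0<\lambda\le\lambda_0$, all $m,n$ and all sets of constraints $\eta$, the mixing time $T_{\rm mix}$ is finite and $$T_{\rm mix}\le C\,mn(m+n).$$ -/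

import Mathlib

/-! # Lattice triangulations of a rectangle and their heat-bath flip dynamics -/

namespace LatticeTriangulation

/-- The point set `{0,…,m} × {0,…,n}`. -/
noncomputable def latticePoints (m n : ℕ) : Finset (ℤ × ℤ) :=
  Finset.Icc 0 (m : ℤ) ×ˢ Finset.Icc 0 (n : ℤ)

/-- A lattice point seen as a point of the real plane. -/
def toPlane (a : ℤ × ℤ) : ℝ × ℝ := ((a.1 : ℝ), (a.2 : ℝ))

/-- The relative interior of the straight line segment joining the two points of `e`. -/
def edgeInterior (e : Sym2 (ℤ × ℤ)) : Set (ℝ × ℝ) :=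
  Sym2.lift ⟨fun a b => openSegment ℝ (toPlane a) (toPlane b),
    fun _ _ => openSegment_symm ℝ _ _⟩ e

/-- The `ℓ₁` length of the segment joining the two points of `e`. -/
def edgeLength (e : Sym2 (ℤ × ℤ)) : ℕ :=
  Sym2.lift ⟨fun a b => (a.1 - b.1).natAbs + (a.2 - b.2).natAbs, fun a b => by
    show (a.1 - b.1).natAbs + (a.2 - b.2).natAbs = (b.1 - a.1).natAbs + (b.2 - a.2).natAbs
    omega⟩ e

/-- Twice the midpoint of the segment joining the two points of `e` (so that it is integral). -/
def doubleMid (e : Sym2 (ℤ × ℤ)) : ℤ × ℤ :=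
  Sym2.lift ⟨fun a b => a + b, fun a b => add_comm a b⟩ e

open Classical in
/-- The possible edges: straight segments joining two distinct points of `{0,…,m} × {0,…,n}`
and passing through no other point of that set. -/
noncomputable def latticeEdges (m n : ℕ) : Finset (Sym2 (ℤ × ℤ)) :=
  (latticePoints m n).sym2.filter fun e =>
    ¬ e.IsDiag ∧ ∀ c ∈ latticePoints m n, toPlane c ∉ edgeInterior e

/-- Two different segments cross if their relative interiors meet. -/
def Crosses (e f : Sym2 (ℤ × ℤ)) : Prop :=
  e ≠ f ∧ (edgeInterior e ∩ edgeInterior f).Nonempty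

/-- A set of segments no two of which cross. -/
def NonCrossing (σ : Finset (Sym2 (ℤ × ℤ))) : Prop :=
  ∀ e ∈ σ, ∀ f ∈ σ, ¬ Crosses e f

/-- A (full) triangulation of `{0,…,m} × {0,…,n}`: a maximal non-crossing set of edges. -/
def IsTriangulation (m n : ℕ) (σ : Finset (Sym2 (ℤ × ℤ))) : Prop :=
  Maximal (fun τ : Finset (Sym2 (ℤ × ℤ)) => τ ⊆ latticeEdges m n ∧ NonCrossing τ) σ

/-- A set of constraints: an arbitrary non-crossing set of edges. Two different edges with the
same midpoint cross, so this is the same as a consistent assignment of edges to a subset of the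
set of midpoints, namely to the midpoints of the edges in `η`. -/
def IsConstraintSet (m n : ℕ) (η : Finset (Sym2 (ℤ × ℤ))) : Prop :=
  η ⊆ latticeEdges m n ∧ NonCrossing η

open Classical in
/-- The set of triangulations that contain all the constraint edges `η`. -/
noncomputable def triangulations (m n : ℕ) (η : Finset (Sym2 (ℤ × ℤ))) :
    Finset (Finset (Sym2 (ℤ × ℤ))) :=
  (latticeEdges m n).powerset.filter fun σ => IsTriangulation m n σ ∧ η ⊆ σ

/-- The state space of the dynamics: the triangulations that contain the constraint edges. -/
abbrev State (m n : ℕ) (η : Finset (Sym2 (ℤ × ℤ))) : Type :=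
  {σ : Finset (Sym2 (ℤ × ℤ)) // σ ∈ triangulations m n η}

/-- The midpoints, in doubled coordinates: the points of the half-integer lattice in the
rectangle `[0,m] × [0,n]` that are not integer points. -/
noncomputable def doubleMidpoints (m n : ℕ) : Finset (ℤ × ℤ) :=
  (Finset.Icc 0 (2 * (m : ℤ)) ×ˢ Finset.Icc 0 (2 * (n : ℤ))).filter fun x =>
    ¬ (Even x.1 ∧ Even x.2)

/-- The midpoints (in doubled coordinates) that do not carry a constraint edge. -/
noncomputable def freeMidpoints (m n : ℕ) (η : Finset (Sym2 (ℤ × ℤ))) : Finset (ℤ × ℤ) :=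
  doubleMidpoints m n \ η.image doubleMid

/-- `τ` is obtained from `σ` by flipping the edge with (doubled) midpoint `x`: this edge `ab` is
a diagonal of a convex quadrilateral `acbd` whose sides are edges of `σ` (convexity says that
the diagonals `ab` and `cd` cross), and it is replaced by the other diagonal `cd`. This is used
only when `σ` and `τ` are both triangulations. -/
def FlipAt (x : ℤ × ℤ) (σ τ : Finset (Sym2 (ℤ × ℤ))) : Prop :=
  ∃ a b c d : ℤ × ℤ, doubleMid s(a, b) = x ∧ s(a, b) ∈ σ ∧
    s(a, c) ∈ σ ∧ s(c, b) ∈ σ ∧ s(b, d) ∈ σ ∧ s(d, a) ∈ σ ∧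
    Crosses s(a, b) s(c, d) ∧ τ = insert s(c, d) (σ.erase s(a, b))

/-- The total `ℓ₁` length of the edges of `σ`. -/
def totalLength (σ : Finset (Sym2 (ℤ × ℤ))) : ℕ := ∑ e ∈ σ, edgeLength e

/-- The Gibbs distribution `μ(σ) = λ ^ |σ| / Z` on the triangulations that contain `η`. -/
noncomputable def gibbs (m n : ℕ) (η : Finset (Sym2 (ℤ × ℤ))) (lam : ℝ) (σ : State m n η) : ℝ :=
  lam ^ totalLength σ.1 / ∑ τ : State m n η, lam ^ totalLength τ.1

open Classical in
/-- The probability that the dynamics moves from `σ` to a different state `τ` in one step: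
a non-constraint midpoint `x` is chosen uniformly at random; if the edge at `x` can be flipped,
and the flip produces `τ`, then it is performed with probability `μ(τ) / (μ(τ) + μ(σ))`. -/
noncomputable def moveProb (m n : ℕ) (η : Finset (Sym2 (ℤ × ℤ))) (lam : ℝ)
    (σ τ : State m n η) : ℝ :=
  ∑ x ∈ freeMidpoints m n η, ((freeMidpoints m n η).card : ℝ)⁻¹ *
    (if FlipAt x σ.1 τ.1 then
      gibbs m n η lam τ / (gibbs m n η lam τ + gibbs m n η lam σ) else 0)

/-- The transition matrix of the heat-bath Glauber dynamics: with the probability not used for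
moves, nothing is done. -/
noncomputable def glauber (m n : ℕ) (η : Finset (Sym2 (ℤ × ℤ))) (lam : ℝ) :
    Matrix (State m n η) (State m n η) ℝ :=
  fun σ τ =>
    if τ = σ then 1 - ∑ τ' ∈ Finset.univ.erase σ, moveProb m n η lam σ τ'
    else moveProb m n η lam σ τ

/-- Total variation distance of two distributions on a finite set. -/
noncomputable def tvDist {S : Type*} [Fintype S] (μ ν : S → ℝ) : ℝ :=
  (1 / 2) * ∑ s, |μ s - ν s|

/-- The set of times `t` at which the law of the dynamics, from every initial state, is within
total variation distance `1/4` of the Gibbs distribution. -/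
def mixedTimes (m n : ℕ) (η : Finset (Sym2 (ℤ × ℤ))) (lam : ℝ) : Set ℕ :=
  {t | ∀ σ : State m n η, tvDist ((glauber m n η lam ^ t) σ) (gibbs m n η lam) ≤ 1 / 4}

/-- The mixing time (meaningful when `mixedTimes` is nonempty). -/
noncomputable def mixingTime (m n : ℕ) (η : Finset (Sym2 (ℤ × ℤ))) (lam : ℝ) : ℕ :=
  sInf (mixedTimes m n η lam)

end LatticeTriangulation

/-! # Mixing of the flip dynamics on lattice triangulations

**Structure.** Every triangulation is unimodular (`IsTriangulation.hasApexes`), so that a flip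
exchanges the diagonals of a unimodular parallelogram (`flipAt_iff`), and any two triangulations
are joined by polynomially many flips that never remove a common edge (`exists_flipPath`). Both
follow from a procedure inserting a given edge `pq` into a unimodular triangulation by flips.
Measure each edge crossing `pq` by its extent orthogonal to `pq`. Among the edges of maximal
extent, the furthest one along `pq` is a diagonal of a parallelogram, and flipping it decreases the
total extent of the crossing edges (`exists_flip_crossingExtent_lt`). Inserting all the edges of an
arbitrary triangulation into the standard one shows that the former arises from the latter by
flips, which preserve unimodularity.

**Contraction.** Give the flip of an edge `ab` to `cd` the weight `5 ^ max |ab| |cd|`. One step of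
the dynamics contracts the weighted Lipschitz constant of every function by the factor
`1 - 1 / (5 N)`, where `N` is the number of free midpoints (`FlipLipschitz.glauber`); this is path
coupling in dual form. If `σ` and `τ` differ by this flip, updates at its midpoint agree, and
updates elsewhere commute with the flip, except at the four sides of the parallelogram `acbd`. A
side can be flipped in at most one of `σ` and `τ` (`IsFlip.not_flip_both`), and for `λ ≤ 1 / 8` the
expected weight of that flip is at most `5 ^ |side|`, since a lengthening flip is accepted with a
probability that outweighs the growth of its weight (`acceptProb_mul_pow_le`). The longer diagonal
is as long as two adjacent sides together (`IsFlip.add_le_max_edgeLength`), so the four sides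
contribute at most `2 / 5 + 2 / 5 < 1` of the weight of the flip.

**Conclusion.** The Gibbs distribution is stationary by detailed balance, so the total variation
distance at time `t` is at most the number of flips between two states times `5 ^ (m + n)` times
`(1 - 1 / (5 N)) ^ t`. As `N = O(mn)` and the prefactor is `exp (O(m + n))`, a time of order
`mn (m + n)` suffices. -/

namespace LatticeTriangulation

/-! ### Orientation and crossing of lattice segments -/

/-- Twice the signed area of the triangle `abc`. -/
def orient (a b c : ℤ × ℤ) : ℤ :=
  (b.1 - a.1) * (c.2 - a.2) - (b.2 - a.2) * (c.1 - a.1)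

lemma orient_swap (a b c : ℤ × ℤ) : orient b a c = -orient a b c := by
  simp only [orient]; ring

lemma orient_rotate (a b c : ℤ × ℤ) : orient b c a = orient a b c := by
  simp only [orient]; ring

lemma mem_edgeInterior {a b : ℤ × ℤ} {z : ℝ × ℝ} :
    z ∈ edgeInterior s(a, b) ↔ ∃ t : ℝ, 0 < t ∧ t < 1 ∧
      z.1 = a.1 + t * (b.1 - a.1) ∧ z.2 = a.2 + t * (b.2 - a.2) := by
  simp only [edgeInterior, Sym2.lift_mk, openSegment_eq_image', Set.mem_image, Set.mem_Ioo,
    toPlane]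
  constructor
  · rintro ⟨t, ⟨h0, h1⟩, rfl⟩
    exact ⟨t, h0, h1, by simp, by simp⟩
  · rintro ⟨t, h0, h1, hx, hy⟩
    exact ⟨t, ⟨h0, h1⟩, by ext <;> simp [hx, hy]⟩

lemma mem_latticeEdges {m n : ℕ} {a b : ℤ × ℤ} :
    s(a, b) ∈ latticeEdges m n ↔ (a ∈ latticePoints m n ∧ b ∈ latticePoints m n) ∧ a ≠ b ∧
      ∀ c ∈ latticePoints m n, toPlane c ∉ edgeInterior s(a, b) := by
  simp [latticeEdges]

lemma Crosses.symm {e f : Sym2 (ℤ × ℤ)} (h : Crosses e f) : Crosses f e :=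
  ⟨h.1.symm, by rw [Set.inter_comm]; exact h.2⟩

/-- Two lattice edges on a common line whose relative interiors meet are equal: otherwise an
endpoint of one of them would be interior to the other. -/
lemma eq_of_collinear {m n : ℕ} {p q r s : ℤ × ℤ} (h1 : s(p, q) ∈ latticeEdges m n)
    (h2 : s(r, s) ∈ latticeEdges m n) (hr : orient p q r = 0) (hs : orient p q s = 0)
    (hz : (edgeInterior s(p, q) ∩ edgeInterior s(r, s)).Nonempty) : s(p, q) = s(r, s) := by
  obtain ⟨⟨hp, hq⟩, hne, hE⟩ := mem_latticeEdges.1 h1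
  obtain ⟨⟨hr', hs'⟩, hne', hF⟩ := mem_latticeEdges.1 h2
  obtain ⟨z, hz1, hz2⟩ := hz
  obtain ⟨t, t0, t1, hx, hy⟩ := mem_edgeInterior.1 hz1
  obtain ⟨w, w0, w1, hx', hy'⟩ := mem_edgeInterior.1 hz2
  -- `L` is the squared length of `pq`; `A`, `B` are the affine coordinates of `r`, `s` on `pq`.
  set L : ℝ := ((q.1 : ℝ) - p.1) ^ 2 + ((q.2 : ℝ) - p.2) ^ 2 with hL
  have hL0 : 0 < L := by
    rcases eq_or_ne p.1 q.1 with h | h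
    · have h' : p.2 ≠ q.2 := fun h' => hne (Prod.ext h h')
      have : ((q.2 : ℝ) - p.2) ≠ 0 := sub_ne_zero.2 (by exact_mod_cast h'.symm)
      positivity
    · have : ((q.1 : ℝ) - p.1) ≠ 0 := sub_ne_zero.2 (by exact_mod_cast h.symm)
      positivity
  have key : ∀ v : ℤ × ℤ, orient p q v = 0 → ∃ A : ℝ,
      (v.1 : ℝ) = p.1 + A * (q.1 - p.1) ∧ (v.2 : ℝ) = p.2 + A * (q.2 - p.2) := by
    intro v hv
    have hv' : ((q.1 : ℝ) - p.1) * (v.2 - p.2) - (q.2 - p.2) * (v.1 - p.1) = 0 := by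
      have := congrArg (Int.cast : ℤ → ℝ) hv
      simpa [orient] using this
    refine ⟨(((q.1 : ℝ) - p.1) * (v.1 - p.1) + (q.2 - p.2) * (v.2 - p.2)) / L, ?_, ?_⟩
    · field_simp
      rw [hL]
      linear_combination (-((q.2 : ℝ) - p.2)) * hv'
    · field_simp
      rw [hL]
      linear_combination ((q.1 : ℝ) - p.1) * hv'
  obtain ⟨A, hA1, hA2⟩ := key r hr
  obtain ⟨B, hB1, hB2⟩ := key s hs
  have hAB : t = A + w * (B - A) := by
    have e1 : (t - (A + w * (B - A))) * ((q.1 : ℝ) - p.1) = 0 := by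
      have := hx.symm.trans hx'
      rw [hA1, hB1] at this
      linear_combination this
    have e2 : (t - (A + w * (B - A))) * ((q.2 : ℝ) - p.2) = 0 := by
      have := hy.symm.trans hy'
      rw [hA2, hB2] at this
      linear_combination this
    have : (t - (A + w * (B - A))) * L = 0 := by
      rw [hL]
      linear_combination ((q.1 : ℝ) - p.1) * e1 + ((q.2 : ℝ) - p.2) * e2
    rcases mul_eq_zero.1 this with h | h
    · linarith
    · exact absurd h hL0.ne'
  have hA : A ≤ 0 ∨ 1 ≤ A := by
    by_contra! h
    exact hE r hr' (mem_edgeInterior.2 ⟨A, h.1, h.2, hA1, hA2⟩)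
  have hB : B ≤ 0 ∨ 1 ≤ B := by
    by_contra! h
    exact hE s hs' (mem_edgeInterior.2 ⟨B, h.1, h.2, hB1, hB2⟩)
  have inside : ∀ v : ℤ × ℤ, v ∈ latticePoints m n → ∀ x : ℝ,
      (v.1 : ℝ) = p.1 + x * (q.1 - p.1) → (v.2 : ℝ) = p.2 + x * (q.2 - p.2) →
      (A < x ∧ x < B ∨ B < x ∧ x < A) → False := by
    intro v hv x h1 h2 h
    have hAB' : B - A ≠ 0 := by rcases h with h | h <;> intro h' <;> linarith
    refine hF v hv (mem_edgeInterior.2 ⟨(x - A) / (B - A), ?_, ?_, ?_, ?_⟩)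
    · rcases h with h | h
      · exact div_pos (by linarith) (by linarith)
      · exact div_pos_of_neg_of_neg (by linarith) (by linarith)
    · rcases h with h | h
      · rw [div_lt_one (by linarith)]; linarith
      · rw [div_lt_one_of_neg (by linarith)]; linarith
    · simp only [toPlane]; rw [h1, hA1, hB1]; field_simp; ring
    · simp only [toPlane]; rw [h2, hA2, hB2]; field_simp; ring
  have in0 := inside p hp 0 (by simp) (by simp)
  have in1 := inside q hq 1 (by simp) (by simp)
  have eqv : ∀ u v : ℤ × ℤ, (u.1 : ℝ) = v.1 → (u.2 : ℝ) = v.2 → u = v := fun u v h h' =>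
    Prod.ext (by exact_mod_cast h) (by exact_mod_cast h')
  rcases hA with hA | hA <;> rcases hB with hB | hB
  · nlinarith
  · have hA0 : A = 0 := le_antisymm hA (not_lt.1 fun h => in0 (Or.inl ⟨h, by linarith⟩))
    have hB1' : B = 1 := le_antisymm (not_lt.1 fun h => in1 (Or.inl ⟨by linarith, h⟩)) hB
    subst hA0 hB1'
    rw [eqv r p (by simpa using hA1) (by simpa using hA2),
      eqv s q (by simpa using hB1) (by simpa using hB2)]
  · have hA0 : B = 0 := le_antisymm hB (not_lt.1 fun h => in0 (Or.inr ⟨h, by linarith⟩))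
    have hB1' : A = 1 := le_antisymm (not_lt.1 fun h => in1 (Or.inr ⟨by linarith, h⟩)) hA
    subst hA0 hB1'
    rw [eqv r q (by simpa using hA1) (by simpa using hA2),
      eqv s p (by simpa using hB1) (by simpa using hB2), Sym2.eq_swap]
  · nlinarith

lemma orient_mul_neg_of_mem {p q r s : ℤ × ℤ} {z : ℝ × ℝ} (h1 : z ∈ edgeInterior s(p, q))
    (h2 : z ∈ edgeInterior s(r, s)) (h : ¬ (orient p q r = 0 ∧ orient p q s = 0)) :
    orient p q r * orient p q s < 0 := by
  obtain ⟨t, t0, t1, hx, hy⟩ := mem_edgeInterior.1 h1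
  obtain ⟨w, w0, w1, hx', hy'⟩ := mem_edgeInterior.1 h2
  have hR : (orient p q r : ℝ) = (q.1 - p.1) * (r.2 - p.2) - (q.2 - p.2) * (r.1 - p.1) := by
    simp [orient]
  have hS : (orient p q s : ℝ) = (q.1 - p.1) * (s.2 - p.2) - (q.2 - p.2) * (s.1 - p.1) := by
    simp [orient]
  -- `orient p q` is affine and vanishes at `z`, which lies strictly between `r` and `s`.
  have e : (1 - w) * (orient p q r : ℝ) + w * orient p q s = 0 := by
    rw [hR, hS]
    linear_combination ((q.1 : ℝ) - p.1) * (hy'.symm.trans hy)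
      - ((q.2 : ℝ) - p.2) * (hx'.symm.trans hx)
  have hr : orient p q r ≠ 0 := by
    intro hr
    refine h ⟨hr, ?_⟩
    rw [hr] at e
    have : w * (orient p q s : ℝ) = 0 := by simpa using e
    rcases mul_eq_zero.1 this with h | h
    · linarith
    · exact_mod_cast h
  have hr' : (0 : ℝ) < (orient p q r : ℝ) ^ 2 := by positivity
  have e' : w * ((orient p q r : ℝ) * orient p q s) = -(1 - w) * (orient p q r : ℝ) ^ 2 := by
    linear_combination (orient p q r : ℝ) * e
  have : ((orient p q r : ℝ) * orient p q s) < 0 := by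
    by_contra! hh
    nlinarith
  exact_mod_cast this

/-- Lattice edges cross precisely when each of them strictly separates the endpoints of the
other. -/
lemma crosses_iff {m n : ℕ} {p q r s : ℤ × ℤ} (h1 : s(p, q) ∈ latticeEdges m n)
    (h2 : s(r, s) ∈ latticeEdges m n) :
    Crosses s(p, q) s(r, s) ↔
      orient p q r * orient p q s < 0 ∧ orient r s p * orient r s q < 0 := by
  constructor
  · rintro ⟨hne, z, hz1, hz2⟩
    exact ⟨orient_mul_neg_of_mem hz1 hz2 fun h => hne (eq_of_collinear h1 h2 h.1 h.2 ⟨z, hz1, hz2⟩),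
      orient_mul_neg_of_mem hz2 hz1 fun h =>
        hne (eq_of_collinear h2 h1 h.1 h.2 ⟨z, hz2, hz1⟩).symm⟩
  · rintro ⟨ha, hb⟩
    refine ⟨?_, ?_⟩
    · intro h
      rcases Sym2.eq_iff.1 h with ⟨rfl, rfl⟩ | ⟨rfl, rfl⟩ <;> simp [orient] at ha
    have hA : ((orient p q r : ℝ) * orient p q s) < 0 := by exact_mod_cast ha
    have hB : ((orient r s p : ℝ) * orient r s q) < 0 := by exact_mod_cast hb
    have hparam : ∀ x y : ℝ, x * y < 0 → 0 < x / (x - y) ∧ x / (x - y) < 1 ∧ x - y ≠ 0 := by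
      intro x y hxy
      rcases mul_neg_iff.1 hxy with ⟨h, h'⟩ | ⟨h, h'⟩
      · exact ⟨div_pos h (by linarith), by rw [div_lt_one (by linarith)]; linarith, by linarith⟩
      · exact ⟨div_pos_of_neg_of_neg h (by linarith),
          by rw [div_lt_one_of_neg (by linarith)]; linarith, by linarith⟩
    obtain ⟨a0, a1, hd⟩ := hparam _ _ hB
    obtain ⟨b0, b1, hd'⟩ := hparam _ _ hA
    have hrel : (orient p q r : ℝ) - orient p q s = -((orient r s p : ℝ) - orient r s q) := by
      simp only [orient]; push_cast; ring
    set D : ℝ := (orient r s p : ℝ) - orient r s q with hD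
    refine ⟨(p.1 + (orient r s p / D) * (q.1 - p.1), p.2 + (orient r s p / D) * (q.2 - p.2)),
      mem_edgeInterior.2 ⟨_, a0, a1, rfl, rfl⟩, mem_edgeInterior.2 ⟨_, b0, b1, ?_, ?_⟩⟩
    all_goals
      rw [hrel]
      have : -D ≠ 0 := neg_ne_zero.2 hd
      simp only
      field_simp
      rw [hD]
      simp only [orient]; push_cast; ring

/-- A lattice edge contains no lattice point strictly inside: `c` on the line `rs` whose height
over some line `ab` is strictly between those of `s` and `r` cannot exist. -/
lemma false_of_between {m n : ℕ} {a b c r s : ℤ × ℤ} (h : s(r, s) ∈ latticeEdges m n)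
    (hc : c ∈ latticePoints m n) (h0 : orient r s c = 0) (h1 : orient a b s < orient a b c)
    (h2 : orient a b c < orient a b r) : False := by
  have h1' : (orient a b s : ℝ) < orient a b c := by exact_mod_cast h1
  have h2' : (orient a b c : ℝ) < orient a b r := by exact_mod_cast h2
  have h0' : ((s.1 : ℝ) - r.1) * (c.2 - r.2) - (s.2 - r.2) * (c.1 - r.1) = 0 := by
    have := congrArg (Int.cast : ℤ → ℝ) h0
    simpa [orient] using this
  have hd : (orient a b s : ℝ) - orient a b r ≠ 0 := by linarith
  refine (mem_latticeEdges.1 h).2.2 c hc (mem_edgeInterior.2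
    ⟨((orient a b c : ℝ) - orient a b r) / (orient a b s - orient a b r),
      div_pos_of_neg_of_neg (by linarith) (by linarith),
      by rw [div_lt_one_of_neg (by linarith)]; linarith, ?_, ?_⟩)
  · simp only [toPlane]
    field_simp
    simp only [orient]; push_cast
    linear_combination ((a.1 : ℝ) - b.1) * h0'
  · simp only [toPlane]
    field_simp
    simp only [orient]; push_cast
    linear_combination ((a.2 : ℝ) - b.2) * h0'

/-- A side of a unimodular triangle is a lattice edge. -/
lemma mem_latticeEdges_of_orient {m n : ℕ} {a b c : ℤ × ℤ} (ha : a ∈ latticePoints m n)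
    (hb : b ∈ latticePoints m n) (h : orient a b c = 1) : s(a, b) ∈ latticeEdges m n := by
  refine mem_latticeEdges.2 ⟨⟨ha, hb⟩, ?_, fun z _ hz => ?_⟩
  · rintro rfl; simp [orient] at h
  · obtain ⟨t, t0, t1, hx, hy⟩ := mem_edgeInterior.1 hz
    have h' : ((b.1 : ℝ) - a.1) * (c.2 - a.2) - (b.2 - a.2) * (c.1 - a.1) = 1 := by
      have := congrArg (Int.cast : ℤ → ℝ) h
      simpa [orient] using this
    -- the parameter `t` would be an integer strictly between `0` and `1`
    have e : ((orient a z c : ℤ) : ℝ) = t := by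
      simp only [toPlane] at hx hy
      simp only [orient]; push_cast
      rw [hx, hy]
      linear_combination t * h'
    rw [← e] at t0 t1
    have t0' : 0 < orient a z c := by exact_mod_cast t0
    have t1' : orient a z c < 1 := by exact_mod_cast t1
    omega

lemma eq_of_doubleMid_eq {e f : Sym2 (ℤ × ℤ)} (h : ¬ Crosses e f)
    (hm : doubleMid e = doubleMid f) : e = f := by
  by_contra hne
  refine h ⟨hne, ?_⟩
  induction e using Sym2.ind with | _ a b =>
  induction f using Sym2.ind with | _ c d =>
  simp only [doubleMid, Sym2.lift_mk, Prod.ext_iff, Prod.fst_add, Prod.snd_add] at hm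
  have h1 : (a.1 : ℝ) + b.1 = c.1 + d.1 := by exact_mod_cast hm.1
  have h2 : (a.2 : ℝ) + b.2 = c.2 + d.2 := by exact_mod_cast hm.2
  refine ⟨(((a.1 : ℝ) + b.1) / 2, ((a.2 : ℝ) + b.2) / 2),
    mem_edgeInterior.2 ⟨1 / 2, by norm_num, by norm_num, ?_, ?_⟩,
    mem_edgeInterior.2 ⟨1 / 2, by norm_num, by norm_num, ?_, ?_⟩⟩ <;> dsimp only <;> linarith

/-! ### Unimodular triangles and triangulations -/

/-- In barycentric coordinates `(α, β, γ)` of a triangle `abc`: if `r` and `s` lie on different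
sides of the line `ab` and the line `rs` separates `a` from `c`, then `r` and `s` lie on different
sides of the line `ca`. The coordinates of `r` and `s` are integral, so `0 < γ` means `1 ≤ γ`. -/
lemma barycentric_separation {β β' γ γ' : ℤ} (h : 0 < γ) (h' : γ' < 0)
    (hx : (β * γ' - γ * β') * ((1 - β - γ) * β' - β * (1 - β' - γ')) < 0) : β * β' < 0 := by
  rcases mul_neg_iff.1 hx with ⟨h1, h2⟩ | ⟨h1, h2⟩
  · have hlt : β' < β := by nlinarith
    have h3 : 0 < β := by
      by_contra! h3
      nlinarith
    have h4 : β' < 0 := by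
      by_contra! h4
      nlinarith
    exact mul_neg_of_pos_of_neg h3 h4
  · have hlt : β < β' := by nlinarith
    have h3 : β < 0 := by
      by_contra! h3
      nlinarith
    have h4 : 0 < β' := by
      by_contra! h4
      nlinarith
    exact mul_neg_of_neg_of_pos h3 h4

lemma crosses_triangle_aux {m n : ℕ} {a b c r s : ℤ × ℤ} (h : orient a b c = 1)
    (hac : s(a, c) ∈ latticeEdges m n) (hbc : s(b, c) ∈ latticeEdges m n)
    (hrs : s(r, s) ∈ latticeEdges m n) (hab : s(a, b) ∈ latticeEdges m n)
    (hx : Crosses s(r, s) s(a, b)) (hr : 0 < orient a b r) (hs : orient a b s < 0) :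
    Crosses s(r, s) s(a, c) ∨ Crosses s(r, s) s(b, c) ∨ r = c := by
  have hcP := (mem_latticeEdges.1 hac).1.2
  obtain ⟨h1, -⟩ := (crosses_iff hrs hab).1 hx
  rw [crosses_iff hrs hac, crosses_iff hrs hbc]
  -- Barycentric coordinates of `r` and `s` in the triangle `abc`; they are integers.
  obtain ⟨β, hβ⟩ : ∃ β, β = orient c a r := ⟨_, rfl⟩
  obtain ⟨β', hβ'⟩ : ∃ β, β = orient c a s := ⟨_, rfl⟩
  obtain ⟨γ, hγ⟩ : ∃ γ, γ = orient a b r := ⟨_, rfl⟩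
  obtain ⟨γ', hγ'⟩ : ∃ γ, γ = orient a b s := ⟨_, rfl⟩
  have hα : orient b c r = 1 - β - γ := by rw [← h, hβ, hγ]; simp only [orient]; ring
  have hα' : orient b c s = 1 - β' - γ' := by rw [← h, hβ', hγ']; simp only [orient]; ring
  have hcr : orient a c r = -β := by rw [hβ, orient_swap]
  have hcs : orient a c s = -β' := by rw [hβ', orient_swap]
  have hA : orient r s a = β * γ' - γ * β' := by
    have : orient r s a * orient a b c = orient c a r * orient a b s
      - orient a b r * orient c a s := by simp only [orient]; ring
    rw [h, mul_one] at this
    rw [this, hβ, hβ', hγ, hγ']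
  have hB : orient r s b = γ * (1 - β' - γ') - (1 - β - γ) * γ' := by
    have : orient r s b * orient a b c = orient a b r * orient b c s
      - orient b c r * orient a b s := by simp only [orient]; ring
    rw [h, mul_one] at this
    rw [this, ← hγ, ← hγ', hα, hα']
  have hC : orient r s c = (1 - β - γ) * β' - β * (1 - β' - γ') := by
    have : orient r s c * orient a b c = orient b c r * orient c a s
      - orient c a r * orient b c s := by simp only [orient]; ring
    rw [h, mul_one] at this
    rw [this, ← hβ, ← hβ', hα, hα']
  rw [hcr, hcs, hα, hα', hA, hB, hC]
  rw [hA, hB] at h1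
  rw [← hγ] at hr
  rw [← hγ'] at hs
  rcases eq_or_ne ((1 - β - γ) * β' - β * (1 - β' - γ')) 0 with h0 | h0
  · -- the line `rs` passes through `c`, which is not strictly between `r` and `s`
    right; right
    rw [← hC] at h0
    have hg : γ = 1 := by
      by_contra hne
      exact false_of_between (a := a) (b := b) hrs hcP h0 (by rw [← hγ', h]; omega)
        (by rw [← hγ, h]; omega)
    have hb : β = 0 := by
      rw [hC, hg] at h0
      have : β * (1 - γ') = 0 := by linear_combination -h0
      rcases mul_eq_zero.1 this with h | h <;> omega
    have e1 : orient a b r = orient a b c := by rw [h, ← hγ, hg]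
    have e2 : orient c a r = 0 := by rw [← hβ, hb]
    have hr1 : r.1 - c.1 = (r.1 - c.1) * orient a b c := by rw [h, mul_one]
    have hr2 : r.2 - c.2 = (r.2 - c.2) * orient a b c := by rw [h, mul_one]
    simp only [orient] at e1 e2 h hr1 hr2
    ext
    · linear_combination hr1 - (a.1 - c.1) * e1 + (b.1 - a.1) * e2
    · linear_combination hr2 - (a.2 - c.2) * e1 + (b.2 - a.2) * e2
  rcases lt_or_gt_of_ne (mul_ne_zero_iff.2 ⟨(mul_ne_zero_iff.1 h1.ne).1, h0⟩) with h2 | h2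
  · left
    exact ⟨h2, by linarith [barycentric_separation hr hs h2]⟩
  · right; left
    have h3 : (γ * (1 - β' - γ') - (1 - β - γ) * γ') *
        ((1 - β - γ) * β' - β * (1 - β' - γ')) < 0 := by
      rcases mul_pos_iff.1 h2 with ⟨h, h'⟩ | ⟨h, h'⟩ <;>
        rcases mul_neg_iff.1 h1 with ⟨k, k'⟩ | ⟨k, k'⟩
      · exact mul_neg_of_neg_of_pos k' h'
      · omega
      · omega
      · exact mul_neg_of_pos_of_neg k' h'
    refine ⟨h3, barycentric_separation hr hs ?_⟩
    linarith

/-- An edge that enters a unimodular triangle of lattice edges through the side `ab` leaves it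
through another side or ends at the apex. -/
lemma crosses_triangle {m n : ℕ} {a b c : ℤ × ℤ} {f : Sym2 (ℤ × ℤ)} (h : |orient a b c| = 1)
    (hac : s(a, c) ∈ latticeEdges m n) (hbc : s(b, c) ∈ latticeEdges m n)
    (hab : s(a, b) ∈ latticeEdges m n) (hf : f ∈ latticeEdges m n)
    (hx : Crosses f s(a, b)) : Crosses f s(a, c) ∨ Crosses f s(b, c) ∨ c ∈ f := by
  wlog h1 : orient a b c = 1 generalizing a b
  · have h2 : orient b a c = 1 := by
      rw [orient_swap]
      rcases (abs_eq zero_le_one).1 h with h | h <;> omega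
    rcases this (by rw [h2]; rfl) hbc hac (Sym2.eq_swap ▸ hab) (Sym2.eq_swap ▸ hx) h2 with
      h | h | h
    · exact Or.inr (Or.inl h)
    · exact Or.inl h
    · exact Or.inr (Or.inr h)
  induction f using Sym2.ind with | _ r s =>
  rcases mul_neg_iff.1 ((crosses_iff hf hab).1 hx).2 with ⟨hr, hs⟩ | ⟨hr, hs⟩
  · rcases crosses_triangle_aux h1 hac hbc hf hab hx hr hs with h | h | rfl
    · exact Or.inl h
    · exact Or.inr (Or.inl h)
    · exact Or.inr (Or.inr (Sym2.mem_mk_left _ _))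
  · rw [Sym2.eq_swap] at hf hx ⊢
    rcases crosses_triangle_aux h1 hac hbc hf hab hx hs hr with h | h | rfl
    · exact Or.inl h
    · exact Or.inr (Or.inl h)
    · exact Or.inr (Or.inr (Sym2.mem_mk_left _ _))

/-- On each side of an edge of a non-crossing set there is at most one unimodular triangle. -/
lemma apex_unique {m n : ℕ} {σ : Finset (Sym2 (ℤ × ℤ))} (hσ : σ ⊆ latticeEdges m n)
    (hnc : NonCrossing σ) {a b c c' : ℤ × ℤ} (h : orient a b c = 1) (h' : orient a b c' = 1)
    (hac : s(a, c) ∈ σ) (hbc : s(b, c) ∈ σ) (hac' : s(a, c') ∈ σ) (hbc' : s(b, c') ∈ σ) :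
    c = c' := by
  have key : orient a b c' = orient a b c := h'.trans h.symm
  -- `c' - c = k (b - a)`; if `k ≠ 0` then `ac'` and `bc`, or `ac` and `bc'`, cross.
  obtain ⟨k, hk⟩ : ∃ k, k = orient a c' c := ⟨_, rfl⟩
  have e1 : c'.1 - c.1 = k * (b.1 - a.1) := by
    have : (c'.1 - c.1) * orient a b c = k * (b.1 - a.1) := by
      rw [hk]
      simp only [orient] at key ⊢
      linear_combination (c.1 - a.1) * key
    rwa [h, mul_one] at this
  have e2 : c'.2 - c.2 = k * (b.2 - a.2) := by
    have : (c'.2 - c.2) * orient a b c = k * (b.2 - a.2) := by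
      rw [hk]
      simp only [orient] at key ⊢
      linear_combination (c.2 - a.2) * key
    rwa [h, mul_one] at this
  have f1 : c'.1 = c.1 + k * (b.1 - a.1) := by linarith
  have f2 : c'.2 = c.2 + k * (b.2 - a.2) := by linarith
  rcases lt_trichotomy k 0 with hk0 | hk0 | hk0
  · exfalso
    refine hnc _ hac _ hbc' ((crosses_iff (hσ hac) (hσ hbc')).2 ⟨?_, ?_⟩)
    · have g1 : orient a c b = -1 := by rw [← h]; simp only [orient]; ring
      have g2 : orient a c c' = -k := by rw [hk]; simp only [orient]; ring
      rw [g1, g2]; linarith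
    · have g1 : orient b c' a = 1 := by rw [orient_rotate]; exact h'
      have g2 : orient b c' c = k := by
        have : orient b c' c = k * orient a b c := by
          simp only [orient]; rw [f1, f2]; ring
        rw [this, h]; ring
      rw [g1, g2]; linarith
  · rw [hk0] at f1 f2
    ext <;> linarith
  · exfalso
    refine hnc _ hac' _ hbc ((crosses_iff (hσ hac') (hσ hbc)).2 ⟨?_, ?_⟩)
    · have g1 : orient a c' b = -1 := by rw [← h']; simp only [orient]; ring
      rw [g1, ← hk]; linarith
    · have g1 : orient b c a = 1 := by rw [orient_rotate]; exact h
      have g2 : orient b c c' = -k := by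
        have : orient b c c' = -k * orient a b c := by
          simp only [orient]; rw [f1, f2]; ring
        rw [this, h]; ring
      rw [g1, g2]; linarith

/-- The apexes `c`, `d` of two unimodular triangles on opposite sides of `ab` satisfy
`c + d - 2a = k (b - a)` for an integer `k`; they form a parallelogram with `ab` when `k = 1`. -/
lemma exists_opposite_apexes {a b c d : ℤ × ℤ} (hc : orient a b c = 1) (hd : orient a b d = -1) :
    ∃ k, k = orient a d c ∧ c.1 + d.1 - 2 * a.1 = k * (b.1 - a.1) ∧
      c.2 + d.2 - 2 * a.2 = k * (b.2 - a.2) := by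
  refine ⟨_, rfl, ?_, ?_⟩
  · have : (c.1 + d.1 - 2 * a.1) * orient a b c = orient a d c * (b.1 - a.1)
        + (orient a b c + orient a b d) * (c.1 - a.1) := by
      simp only [orient]; ring
    rw [hd, hc] at this; linarith
  · have : (c.2 + d.2 - 2 * a.2) * orient a b c = orient a d c * (b.2 - a.2)
        + (orient a b c + orient a b d) * (c.2 - a.2) := by
      simp only [orient]; ring
    rw [hd, hc] at this; linarith

lemma IsTriangulation.subset {m n : ℕ} {σ : Finset (Sym2 (ℤ × ℤ))} (h : IsTriangulation m n σ) :
    σ ⊆ latticeEdges m n := h.prop.1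

lemma IsTriangulation.nonCrossing {m n : ℕ} {σ : Finset (Sym2 (ℤ × ℤ))}
    (h : IsTriangulation m n σ) : NonCrossing σ := h.prop.2

lemma not_crosses_self (e : Sym2 (ℤ × ℤ)) : ¬ Crosses e e := fun h => h.1 rfl

lemma isTriangulation_iff {m n : ℕ} {σ : Finset (Sym2 (ℤ × ℤ))} :
    IsTriangulation m n σ ↔ σ ⊆ latticeEdges m n ∧ NonCrossing σ ∧
      ∀ e ∈ latticeEdges m n, (∀ f ∈ σ, ¬ Crosses e f) → e ∈ σ := by
  classical
  constructor
  · intro h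
    refine ⟨h.subset, h.nonCrossing, fun e he hc => ?_⟩
    refine h.le_of_ge (y := insert e σ) ⟨?_, ?_⟩ (Finset.subset_insert _ _)
      (Finset.mem_insert_self _ _)
    · exact Finset.insert_subset he h.subset
    · intro f hf g hg
      rw [Finset.mem_insert] at hf hg
      rcases hf with rfl | hf <;> rcases hg with rfl | hg
      · exact not_crosses_self _
      · exact hc g hg
      · exact fun h => hc f hf h.symm
      · exact h.nonCrossing f hf g hg
  · rintro ⟨h1, h2, h3⟩
    refine ⟨⟨h1, h2⟩, fun τ hτ hle e he => h3 e (hτ.1 he) fun f hf => hτ.2 e he f (hle hf)⟩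

/-- `τ` arises from `σ` by replacing the diagonal `ab` of a unimodular parallelogram `acbd`,
with `c` to the left of `ab`, by the diagonal `cd`. -/
structure IsFlip (σ τ : Finset (Sym2 (ℤ × ℤ))) (a b c d : ℤ × ℤ) : Prop where
  orient_eq : orient a b c = 1
  add_eq : a + b = c + d
  mem : s(a, b) ∈ σ
  mem_ac : s(a, c) ∈ σ
  mem_bc : s(b, c) ∈ σ
  mem_ad : s(a, d) ∈ σ
  mem_bd : s(b, d) ∈ σ
  eq_insert : τ = insert s(c, d) (σ.erase s(a, b))

namespace IsFlip

variable {m n : ℕ} {σ τ : Finset (Sym2 (ℤ × ℤ))} {a b c d : ℤ × ℤ}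

lemma fst_eq (h : IsFlip σ τ a b c d) : d.1 = a.1 + b.1 - c.1 := by
  have := congrArg Prod.fst h.add_eq
  simp at this; omega

lemma snd_eq (h : IsFlip σ τ a b c d) : d.2 = a.2 + b.2 - c.2 := by
  have := congrArg Prod.snd h.add_eq
  simp at this; omega

lemma orient_abd (h : IsFlip σ τ a b c d) : orient a b d = -1 := by
  rw [← h.orient_eq]; simp only [orient]; rw [h.fst_eq, h.snd_eq]; ring

lemma orient_cda (h : IsFlip σ τ a b c d) : orient c d a = -1 := by
  rw [← h.orient_eq]; simp only [orient]; rw [h.fst_eq, h.snd_eq]; ring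

lemma orient_cdb (h : IsFlip σ τ a b c d) : orient c d b = 1 := by
  rw [← h.orient_eq]; simp only [orient]; rw [h.fst_eq, h.snd_eq]; ring

lemma swap (h : IsFlip σ τ a b c d) : IsFlip σ τ b a d c where
  orient_eq := by rw [orient_swap, h.orient_abd]; rfl
  add_eq := by rw [add_comm b a, add_comm d c]; exact h.add_eq
  mem := Sym2.eq_swap ▸ h.mem
  mem_ac := h.mem_bd
  mem_bc := h.mem_ad
  mem_ad := h.mem_bc
  mem_bd := h.mem_ac
  eq_insert := by rw [Sym2.eq_swap (a := d), Sym2.eq_swap (a := b)]; exact h.eq_insert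

lemma cd_mem_latticeEdges (hσ : σ ⊆ latticeEdges m n) (h : IsFlip σ τ a b c d) :
    s(c, d) ∈ latticeEdges m n :=
  mem_latticeEdges_of_orient (mem_latticeEdges.1 (hσ h.mem_ac)).1.2
    (mem_latticeEdges.1 (hσ h.mem_ad)).1.2 h.orient_cdb

lemma crosses (hσ : σ ⊆ latticeEdges m n) (h : IsFlip σ τ a b c d) :
    Crosses s(a, b) s(c, d) := by
  rw [crosses_iff (hσ h.mem) (h.cd_mem_latticeEdges hσ), h.orient_eq, h.orient_abd, h.orient_cda,
    h.orient_cdb]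
  norm_num

/-- An edge crossing one diagonal of the parallelogram of a flip and none of its sides is the
other diagonal. -/
lemma eq_of_crosses (hσ : σ ⊆ latticeEdges m n) (h : IsFlip σ τ a b c d) {f : Sym2 (ℤ × ℤ)}
    (hf : f ∈ latticeEdges m n) (hx : Crosses f s(a, b)) (h1 : ¬ Crosses f s(a, c))
    (h2 : ¬ Crosses f s(b, c)) (h3 : ¬ Crosses f s(a, d)) (h4 : ¬ Crosses f s(b, d)) :
    f = s(c, d) := by
  have hc := crosses_triangle (by rw [h.orient_eq]; rfl) (hσ h.mem_ac) (hσ h.mem_bc) (hσ h.mem)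
    hf hx
  have hd := crosses_triangle (by rw [h.orient_abd]; rfl) (hσ h.mem_ad) (hσ h.mem_bd) (hσ h.mem)
    hf hx
  have hcd : c ≠ d := (mem_latticeEdges.1 (h.cd_mem_latticeEdges hσ)).2.1
  exact (Sym2.mem_and_mem_iff hcd).1 ⟨by tauto, by tauto⟩

lemma mid_eq (h : IsFlip σ τ a b c d) : doubleMid s(a, b) = doubleMid s(c, d) := h.add_eq

lemma ne_of_doubleMid {e f : Sym2 (ℤ × ℤ)} (h : doubleMid e ≠ doubleMid f) : e ≠ f := by
  rintro rfl; exact h rfl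

lemma ne_points (hσ : σ ⊆ latticeEdges m n) (h : IsFlip σ τ a b c d) :
    a ≠ b ∧ a ≠ c ∧ b ≠ c ∧ a ≠ d ∧ b ≠ d ∧ c ≠ d :=
  ⟨(mem_latticeEdges.1 (hσ h.mem)).2.1, (mem_latticeEdges.1 (hσ h.mem_ac)).2.1,
    (mem_latticeEdges.1 (hσ h.mem_bc)).2.1, (mem_latticeEdges.1 (hσ h.mem_ad)).2.1,
    (mem_latticeEdges.1 (hσ h.mem_bd)).2.1,
    (mem_latticeEdges.1 (h.cd_mem_latticeEdges hσ)).2.1⟩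

lemma mem_of_ne (h : IsFlip σ τ a b c d) {e : Sym2 (ℤ × ℤ)} (he : e ∈ σ) (hne : e ≠ s(a, b)) :
    e ∈ τ := by
  rw [h.eq_insert]
  exact Finset.mem_insert_of_mem (Finset.mem_erase.2 ⟨hne, he⟩)

lemma cd_mem (h : IsFlip σ τ a b c d) : s(c, d) ∈ τ := by
  rw [h.eq_insert]; exact Finset.mem_insert_self _ _

lemma symm (hσ : IsTriangulation m n σ) (h : IsFlip σ τ a b c d) : IsFlip τ σ c d b a := by
  obtain ⟨hab, hac, hbc, had, hbd, hcd⟩ := h.ne_points hσ.subset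
  have hne : ∀ u v : ℤ × ℤ, (u = c ∨ u = d) → s(u, v) ≠ s(a, b) := by
    rintro u v (rfl | rfl) he <;> rcases Sym2.eq_iff.1 he with ⟨h1, -⟩ | ⟨h1, -⟩ <;> simp_all
  have hcdσ : s(c, d) ∉ σ := fun hc => hσ.nonCrossing _ h.mem _ hc (h.crosses hσ.subset)
  refine ⟨h.orient_cdb, ?_, h.cd_mem, ?_, ?_, ?_, ?_, ?_⟩
  · rw [← h.add_eq, add_comm]
  · exact h.mem_of_ne (Sym2.eq_swap ▸ h.mem_bc) (hne _ _ (Or.inl rfl))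
  · exact h.mem_of_ne (Sym2.eq_swap ▸ h.mem_bd) (hne _ _ (Or.inr rfl))
  · exact h.mem_of_ne (Sym2.eq_swap ▸ h.mem_ac) (hne _ _ (Or.inl rfl))
  · exact h.mem_of_ne (Sym2.eq_swap ▸ h.mem_ad) (hne _ _ (Or.inr rfl))
  · rw [h.eq_insert, Finset.erase_insert (fun hc => hcdσ (Finset.mem_of_mem_erase hc)),
      Sym2.eq_swap (a := b), Finset.insert_erase h.mem]

lemma isTriangulation (hσ : IsTriangulation m n σ) (h : IsFlip σ τ a b c d) :
    IsTriangulation m n τ := by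
  have h' := h.symm hσ
  have hsub : τ ⊆ latticeEdges m n := by
    rw [h.eq_insert]
    exact Finset.insert_subset (h.cd_mem_latticeEdges hσ.subset)
      ((Finset.erase_subset _ _).trans hσ.subset)
  -- an edge of `σ` crossing `cd` crosses no side, hence is `ab`
  have hcd : ∀ f ∈ σ, f ≠ s(a, b) → ¬ Crosses f s(c, d) := fun f hf hne hx =>
    hne <| Eq.trans (h'.eq_of_crosses hsub (hσ.subset hf) hx
      (Sym2.eq_swap (a := c) ▸ hσ.nonCrossing _ hf _ h.mem_bc)
      (Sym2.eq_swap (a := d) ▸ hσ.nonCrossing _ hf _ h.mem_bd)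
      (Sym2.eq_swap (a := c) ▸ hσ.nonCrossing _ hf _ h.mem_ac)
      (Sym2.eq_swap (a := d) ▸ hσ.nonCrossing _ hf _ h.mem_ad)) Sym2.eq_swap
  refine isTriangulation_iff.2 ⟨hsub, ?_, ?_⟩
  · intro e he f hf
    rw [h.eq_insert, Finset.mem_insert, Finset.mem_erase] at he hf
    rcases he with rfl | ⟨hne, he⟩ <;> rcases hf with rfl | ⟨hnf, hf⟩
    · exact not_crosses_self _
    · exact fun hx => hcd f hf hnf hx.symm
    · exact hcd e he hne
    · exact hσ.nonCrossing _ he _ hf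
  · intro e he hx
    by_cases hc : Crosses e s(a, b)
    · -- `e` crosses no side, hence is `cd`
      rw [h.eq_of_crosses hσ.subset he hc (Sym2.eq_swap (a := a) ▸ hx _ h'.mem_ad)
        (Sym2.eq_swap (a := b) ▸ hx _ h'.mem_ac) (Sym2.eq_swap (a := a) ▸ hx _ h'.mem_bd)
        (Sym2.eq_swap (a := b) ▸ hx _ h'.mem_bc)]
      exact h.cd_mem
    · have : e ∈ σ := (isTriangulation_iff.1 hσ).2.2 e he fun f hf => by
        by_cases hfe : f = s(a, b)
        · rw [hfe]; exact hc
        · exact hx f (h.mem_of_ne hf hfe)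
      refine h.mem_of_ne this ?_
      rintro rfl
      exact hx _ h.cd_mem (h.crosses hσ.subset)

end IsFlip

/-! ### Triangulations in which every edge has a unimodular triangle on each side -/

/-- Every edge of `σ` bounds a unimodular triangle of edges of `σ` on each of its sides that
contains a point of the rectangle. -/
def HasApexes (m n : ℕ) (σ : Finset (Sym2 (ℤ × ℤ))) : Prop :=
  ∀ a b, s(a, b) ∈ σ → (∃ p ∈ latticePoints m n, 0 < orient a b p) →
    ∃ c, orient a b c = 1 ∧ s(a, c) ∈ σ ∧ s(b, c) ∈ σ

/-- If a triangle on the edge `xy` disappears in a flip, then `xy` is a side of the parallelogram,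
and it bounds one of the two new triangles. -/
lemma IsFlip.exists_apex {m n : ℕ} {σ τ : Finset (Sym2 (ℤ × ℤ))} {a b c d : ℤ × ℤ}
    (hσ : IsTriangulation m n σ) (h : IsFlip σ τ a b c d) {x y r : ℤ × ℤ}
    (hr : orient x y r = 1) (hxy : s(x, y) ∈ σ) (hxr : s(x, r) ∈ σ) (hyr : s(y, r) ∈ σ)
    (hv : x = a ∧ r = b ∨ y = a ∧ r = b) :
    ∃ z, orient x y z = 1 ∧ s(x, z) ∈ τ ∧ s(y, z) ∈ τ := by
  have h' := h.symm hσ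
  rcases hv with ⟨rfl, rfl⟩ | ⟨rfl, rfl⟩
  · have hy : y = d := apex_unique hσ.subset hσ.nonCrossing
      (by rw [← hr]; simp only [orient]; ring : orient r x y = 1)
      (by rw [orient_swap, h.orient_abd]; rfl) (Sym2.eq_swap ▸ hyr) hxy h.mem_bd h.mem_ad
    subst hy
    refine ⟨c, ?_, Sym2.eq_swap ▸ h'.mem_ad, Sym2.eq_swap ▸ h.cd_mem⟩
    have := h.orient_cda
    simp only [orient] at this ⊢
    linarith
  · have hx : x = c := apex_unique hσ.subset hσ.nonCrossing
      (by rw [← hr]; simp only [orient]; ring : orient y r x = 1)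
      h.orient_eq (Sym2.eq_swap ▸ hxy) (Sym2.eq_swap ▸ hxr) h.mem_ac h.mem_bc
    subst hx
    refine ⟨d, ?_, h.cd_mem, Sym2.eq_swap ▸ h'.mem_bd⟩
    have := h.orient_cda
    simp only [orient] at this ⊢
    linarith

lemma IsFlip.hasApexes {m n : ℕ} {σ τ : Finset (Sym2 (ℤ × ℤ))} {a b c d : ℤ × ℤ}
    (hσ : IsTriangulation m n σ) (hA : HasApexes m n σ) (h : IsFlip σ τ a b c d) :
    HasApexes m n τ := by
  have h' := h.symm hσ
  intro x y hxy hp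
  by_cases hcd : s(x, y) = s(c, d)
  · rcases Sym2.eq_iff.1 hcd with ⟨rfl, rfl⟩ | ⟨rfl, rfl⟩
    · exact ⟨b, h.orient_cdb, h'.mem_ac, h'.mem_bc⟩
    · exact ⟨a, by rw [orient_swap, h.orient_cda]; rfl, h'.mem_bd, h'.mem_ad⟩
  have hxyσ : s(x, y) ∈ σ := by
    rw [h.eq_insert] at hxy
    exact Finset.mem_of_mem_erase ((Finset.mem_insert.1 hxy).resolve_left hcd)
  obtain ⟨r, hr, hxr, hyr⟩ := hA x y hxyσ hp
  by_cases h1 : s(x, r) = s(a, b)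
  · rcases Sym2.eq_iff.1 h1 with h1 | h1
    · exact h.exists_apex hσ hr hxyσ hxr hyr (Or.inl h1)
    · exact h.swap.exists_apex hσ hr hxyσ hxr hyr (Or.inl h1)
  by_cases h2 : s(y, r) = s(a, b)
  · rcases Sym2.eq_iff.1 h2 with h2 | h2
    · exact h.exists_apex hσ hr hxyσ hxr hyr (Or.inr h2)
    · exact h.swap.exists_apex hσ hr hxyσ hxr hyr (Or.inr h2)
  exact ⟨r, hr, h.mem_of_ne hxr h1, h.mem_of_ne hyr h2⟩

lemma mem_latticePoints {m n : ℕ} {a : ℤ × ℤ} :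
    a ∈ latticePoints m n ↔ (0 ≤ a.1 ∧ a.1 ≤ m) ∧ 0 ≤ a.2 ∧ a.2 ≤ n := by
  simp [latticePoints]

/-- The unit segments and the diagonals of the unit squares in direction `(1, 1)`. -/
def IsStandard (e : Sym2 (ℤ × ℤ)) : Prop :=
  ∃ a u : ℤ × ℤ, (u = (1, 0) ∨ u = (0, 1) ∨ u = (1, 1)) ∧ e = s(a, a + u)

open Classical in
/-- The triangulation of the rectangle by unit squares with their diagonals in direction
`(1, 1)`. -/
noncomputable def standardTriangulation (m n : ℕ) : Finset (Sym2 (ℤ × ℤ)) :=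
  (latticeEdges m n).filter IsStandard

lemma mem_standardTriangulation_iff {m n : ℕ} {e : Sym2 (ℤ × ℤ)} :
    e ∈ standardTriangulation m n ↔ e ∈ latticeEdges m n ∧ IsStandard e := by
  simp [standardTriangulation]

lemma mem_standardTriangulation {m n : ℕ} {a b u : ℤ × ℤ} (ha : a ∈ latticePoints m n)
    (hb : b ∈ latticePoints m n) (hu : u = (1, 0) ∨ u = (0, 1) ∨ u = (1, 1)) (h : b = a + u) :
    s(a, b) ∈ standardTriangulation m n := by
  refine mem_standardTriangulation_iff.2 ⟨?_, a, u, hu, by rw [h]⟩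
  rw [Sym2.eq_swap]
  rcases hu with rfl | rfl | rfl
  · exact mem_latticeEdges_of_orient hb ha (c := a + (0, -1)) (by simp [orient, h])
  · exact mem_latticeEdges_of_orient hb ha (c := a + (1, 0)) (by simp [orient, h])
  · exact mem_latticeEdges_of_orient hb ha (c := a + (1, 0)) (by simp [orient, h])

lemma standardTriangulation_nonCrossing (m n : ℕ) : NonCrossing (standardTriangulation m n) := by
  intro e he f hf hx
  obtain ⟨he, a, u, hu, rfl⟩ := mem_standardTriangulation_iff.1 he
  obtain ⟨hf, b, v, hv, rfl⟩ := mem_standardTriangulation_iff.1 hf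
  have h := ((crosses_iff he hf).1 hx).1
  -- the two factors differ by at most one
  have key : orient a (a + u) (b + v) - orient a (a + u) b = u.1 * v.2 - u.2 * v.1 := by
    simp only [orient, Prod.fst_add, Prod.snd_add]; ring
  have hd : u.1 * v.2 - u.2 * v.1 = 0 ∨ u.1 * v.2 - u.2 * v.1 = 1 ∨
      u.1 * v.2 - u.2 * v.1 = -1 := by
    rcases hu with rfl | rfl | rfl <;> rcases hv with rfl | rfl | rfl <;> simp
  rcases mul_neg_iff.1 h with ⟨h1, h2⟩ | ⟨h1, h2⟩ <;> omega

lemma standardTriangulation_isTriangulation (m n : ℕ) :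
    IsTriangulation m n (standardTriangulation m n) := by
  refine isTriangulation_iff.2 ⟨fun e he => (mem_standardTriangulation_iff.1 he).1,
    standardTriangulation_nonCrossing m n,
    fun e he hx => ?_⟩
  obtain ⟨a, b, rfl, hab⟩ : ∃ a b : ℤ × ℤ, e = s(a, b) ∧ (a.1 < b.1 ∨ a.1 = b.1 ∧ a.2 < b.2) := by
    induction e using Sym2.ind with | _ a b =>
    have hne := (mem_latticeEdges.1 he).2.1
    have hne' : a.1 ≠ b.1 ∨ a.2 ≠ b.2 := by
      by_contra! h
      exact hne (Prod.ext h.1 h.2)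
    by_cases h : a.1 < b.1 ∨ a.1 = b.1 ∧ a.2 < b.2
    · exact ⟨a, b, rfl, h⟩
    · exact ⟨b, a, Sym2.eq_swap, by omega⟩
  have hP := (mem_latticeEdges.1 he).1
  have ha := mem_latticePoints.1 hP.1
  have hb := mem_latticePoints.1 hP.2
  have he' : s(b, a) ∈ latticeEdges m n := Sym2.eq_swap ▸ he
  have hcross : ∀ r s u : ℤ × ℤ, r ∈ latticePoints m n → s ∈ latticePoints m n →
      (u = (1, 0) ∨ u = (0, 1) ∨ u = (1, 1)) → s = r + u →
      ¬ (orient a b r * orient a b s < 0 ∧ orient r s a * orient r s b < 0) := by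
    intro r s u hr hs hu hsu h
    have hm := mem_standardTriangulation hr hs hu hsu
    exact hx _ hm ((crosses_iff he (mem_standardTriangulation_iff.1 hm).1).2 h)
  rcases hab with h1 | ⟨h1, h2⟩
  · rcases lt_trichotomy a.2 b.2 with h2 | h2 | h2
    · rcases lt_trichotomy (b.1 - a.1) (b.2 - a.2) with h3 | h3 | h3
      · exfalso
        refine hcross (a.1, a.2 + 1) (a.1 + 1, a.2 + 1) (1, 0)
          (mem_latticePoints.2 (by simp; omega)) (mem_latticePoints.2 (by simp; omega))
          (Or.inl rfl) (by simp) ⟨?_, ?_⟩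
        · simp only [orient]; nlinarith
        · simp only [orient]; nlinarith
      · by_cases h4 : b.1 = a.1 + 1
        · exact mem_standardTriangulation hP.1 hP.2 (Or.inr (Or.inr rfl))
            (Prod.ext (by simp; omega) (by simp; omega))
        · exfalso
          refine false_of_between (a := a) (b := (a.1, a.2 - 1)) (c := (a.1 + 1, a.2 + 1)) he'
            (mem_latticePoints.2 (by simp; omega)) ?_ ?_ ?_
          · simp only [orient]; linear_combination -h3
          · simp only [orient]; nlinarith
          · simp only [orient]; nlinarith [lt_of_le_of_ne (Int.add_one_le_iff.2 h1) (Ne.symm h4)]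
      · exfalso
        refine hcross (a.1 + 1, a.2) (a.1 + 1, a.2 + 1) (0, 1)
          (mem_latticePoints.2 (by simp; omega)) (mem_latticePoints.2 (by simp; omega))
          (Or.inr (Or.inl rfl)) (by simp) ⟨?_, ?_⟩
        · simp only [orient]; nlinarith
        · simp only [orient]; nlinarith
    · by_cases h4 : b.1 = a.1 + 1
      · exact mem_standardTriangulation hP.1 hP.2 (Or.inl rfl)
          (Prod.ext (by simp; omega) (by simp; omega))
      · exfalso
        refine false_of_between (a := a) (b := (a.1, a.2 - 1)) (c := (a.1 + 1, a.2)) he'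
          (mem_latticePoints.2 (by simp; omega)) ?_ ?_ ?_
        · simp only [orient]; rw [h2]; ring
        · simp only [orient]; nlinarith
        · simp only [orient]; nlinarith [lt_of_le_of_ne (Int.add_one_le_iff.2 h1) (Ne.symm h4)]
    · exfalso
      refine hcross (a.1, a.2 - 1) (a.1 + 1, a.2) (1, 1) (mem_latticePoints.2 (by simp; omega))
        (mem_latticePoints.2 (by simp; omega)) (Or.inr (Or.inr rfl)) (by simp) ⟨?_, ?_⟩
      · simp only [orient]; nlinarith
      · simp only [orient]; nlinarith
  · by_cases h4 : b.2 = a.2 + 1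
    · exact mem_standardTriangulation hP.1 hP.2 (Or.inr (Or.inl rfl))
        (Prod.ext (by simp; omega) (by simp; omega))
    · exfalso
      refine false_of_between (a := a) (b := (a.1 + 1, a.2)) (c := (a.1, a.2 + 1)) he'
        (mem_latticePoints.2 (by simp; omega)) ?_ ?_ ?_
      · simp only [orient]; rw [h1]; ring
      · simp only [orient]; nlinarith
      · simp only [orient]; nlinarith [lt_of_le_of_ne (Int.add_one_le_iff.2 h2) (Ne.symm h4)]

lemma standardTriangulation_hasApexes (m n : ℕ) : HasApexes m n (standardTriangulation m n) := by
  rintro x y hxy ⟨p, hp, hpo⟩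
  obtain ⟨he, a, u, hu, hau⟩ := mem_standardTriangulation_iff.1 hxy
  obtain ⟨hx, hy⟩ := (mem_latticeEdges.1 he).1
  have hx' := mem_latticePoints.1 hx
  have hy' := mem_latticePoints.1 hy
  have hp' := mem_latticePoints.1 hp
  rcases Sym2.eq_iff.1 hau with ⟨rfl, rfl⟩ | ⟨rfl, rfl⟩ <;> rcases hu with rfl | rfl | rfl <;>
    simp [orient] at hx' hy' hpo
  · have hc : x + (1, 1) ∈ latticePoints m n := mem_latticePoints.2 (by simp; omega)
    exact ⟨_, by simp [orient], mem_standardTriangulation hx hc (Or.inr (Or.inr rfl)) rfl,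
      mem_standardTriangulation hy hc (Or.inr (Or.inl rfl)) (by ext <;> simp)⟩
  · have hc : x - (1, 0) ∈ latticePoints m n := mem_latticePoints.2 (by simp; omega)
    refine ⟨_, by simp [orient], Sym2.eq_swap ▸ mem_standardTriangulation hc hx (Or.inl rfl) ?_,
      Sym2.eq_swap ▸ mem_standardTriangulation hc hy (Or.inr (Or.inr rfl)) ?_⟩ <;> ext <;> simp
  · have hc : x + (0, 1) ∈ latticePoints m n := mem_latticePoints.2 (by simp; omega)
    exact ⟨_, by simp [orient], mem_standardTriangulation hx hc (Or.inr (Or.inl rfl)) rfl,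
      Sym2.eq_swap ▸ mem_standardTriangulation hc hy (Or.inl rfl) (by ext <;> simp)⟩
  · have hc : y - (0, 1) ∈ latticePoints m n := mem_latticePoints.2 (by simp; omega)
    refine ⟨_, by simp [orient],
      Sym2.eq_swap ▸ mem_standardTriangulation hc hx (Or.inr (Or.inr rfl)) ?_,
      Sym2.eq_swap ▸ mem_standardTriangulation hc hy (Or.inr (Or.inl rfl)) ?_⟩ <;> ext <;> simp
  · have hc : y + (1, 1) ∈ latticePoints m n := mem_latticePoints.2 (by simp; omega)
    exact ⟨_, by simp [orient], mem_standardTriangulation hx hc (Or.inl rfl) (by ext <;> simp),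
      mem_standardTriangulation hy hc (Or.inr (Or.inr rfl)) rfl⟩
  · have hc : y + (1, 0) ∈ latticePoints m n := mem_latticePoints.2 (by simp; omega)
    exact ⟨_, by simp [orient],
      Sym2.eq_swap ▸ mem_standardTriangulation hc hx (Or.inr (Or.inl rfl)) (by ext <;> simp),
      mem_standardTriangulation hy hc (Or.inl rfl) rfl⟩

/-! ### Inserting an edge by flips -/

/-- The extent of the segment `g` in the direction orthogonal to `pq`, scaled by the length
of `pq`. -/
def span (p q : ℤ × ℤ) (g : Sym2 (ℤ × ℤ)) : ℕ :=
  Sym2.lift ⟨fun a b => (orient p q a - orient p q b).natAbs, fun a b => by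
    show (orient p q a - orient p q b).natAbs = (orient p q b - orient p q a).natAbs
    omega⟩ g

lemma span_mk (p q a b : ℤ × ℤ) : span p q s(a, b) = (orient p q a - orient p q b).natAbs := rfl

open Classical in
/-- The total extent, orthogonally to `pq`, of the edges of `ρ` that cross `pq`. -/
noncomputable def crossingExtent (p q : ℤ × ℤ) (ρ : Finset (Sym2 (ℤ × ℤ))) : ℕ :=
  ∑ g ∈ ρ, if Crosses g s(p, q) then span p q g else 0

/-- The scalar product with `q - p`. -/
def along (p q z : ℤ × ℤ) : ℤ := (q.1 - p.1) * z.1 + (q.2 - p.2) * z.2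

lemma along_add (p q z w : ℤ × ℤ) : along p q (z + w) = along p q z + along p q w := by
  simp only [along, Prod.fst_add, Prod.snd_add]; ring

/-- Among the edges crossing `pq` whose extent orthogonally to `pq` is maximal, the one whose
midpoint is furthest in the direction of `pq` can be flipped, and this decreases the total extent
of the edges crossing `pq`. -/
lemma exists_flip_crossingExtent_lt {m n : ℕ} {ρ : Finset (Sym2 (ℤ × ℤ))} {p q : ℤ × ℤ}
    (hρ : IsTriangulation m n ρ) (hA : HasApexes m n ρ) (he : s(p, q) ∈ latticeEdges m n)
    (hx : ∃ g ∈ ρ, Crosses s(p, q) g) :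
    ∃ a b c d ρ', IsFlip ρ ρ' a b c d ∧ Crosses s(p, q) s(a, b) ∧
      crossingExtent p q ρ' < crossingExtent p q ρ := by
  classical
  obtain ⟨g, hg, hmax⟩ := (ρ.filter (Crosses s(p, q))).exists_max_image
    (fun g => toLex (span p q g, along p q (doubleMid g)))
    (by obtain ⟨g, hg, hx⟩ := hx; exact ⟨g, Finset.mem_filter.2 ⟨hg, hx⟩⟩)
  obtain ⟨hgρ, hgx⟩ := Finset.mem_filter.1 hg
  obtain ⟨a, b, rfl, ha, hb⟩ : ∃ a b, g = s(a, b) ∧ orient p q a < 0 ∧ 0 < orient p q b := by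
    induction g using Sym2.ind with | _ a b =>
    rcases mul_neg_iff.1 ((crosses_iff he (hρ.subset hgρ)).1 hgx).1 with ⟨h1, h2⟩ | ⟨h1, h2⟩
    · exact ⟨b, a, Sym2.eq_swap, h2, h1⟩
    · exact ⟨a, b, rfl, h1, h2⟩
  have hmax' : ∀ u v : ℤ × ℤ, s(u, v) ∈ ρ → Crosses s(p, q) s(u, v) →
      span p q s(u, v) < span p q s(a, b) ∨ span p q s(u, v) = span p q s(a, b) ∧
        along p q u + along p q v ≤ along p q a + along p q b := by
    intro u v h1 h2
    have := Prod.Lex.toLex_le_toLex.1 (hmax _ (Finset.mem_filter.2 ⟨h1, h2⟩))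
    rw [← along_add, ← along_add]
    exact this
  simp only [span_mk] at hmax'
  have hPp : p ∈ latticePoints m n := (mem_latticeEdges.1 he).1.1
  have hPq : q ∈ latticePoints m n := (mem_latticeEdges.1 he).1.2
  have hside := ((crosses_iff he (hρ.subset hgρ)).1 hgx).2
  obtain ⟨c, hc, hac, hbc⟩ : ∃ c, orient a b c = 1 ∧ s(a, c) ∈ ρ ∧ s(b, c) ∈ ρ := by
    refine hA a b hgρ ?_
    rcases mul_neg_iff.1 hside with ⟨h, -⟩ | ⟨-, h⟩
    exacts [⟨p, hPp, h⟩, ⟨q, hPq, h⟩]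
  obtain ⟨d, hd, hbd, had⟩ : ∃ d, orient b a d = 1 ∧ s(b, d) ∈ ρ ∧ s(a, d) ∈ ρ := by
    refine hA b a (Sym2.eq_swap ▸ hgρ) ?_
    rcases mul_neg_iff.1 hside with ⟨-, h⟩ | ⟨h, -⟩
    exacts [⟨q, hPq, by rw [orient_swap]; omega⟩, ⟨p, hPp, by rw [orient_swap]; omega⟩]
  have hd' : orient a b d = -1 := by rw [orient_swap, hd]
  have hend : ∀ r : ℤ × ℤ, r ∈ s(p, q) → orient p q r = 0 := by
    intro r hr
    rcases Sym2.mem_iff.1 hr with rfl | rfl <;> simp only [orient] <;> ring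
  have hexit : ∀ r : ℤ × ℤ, |orient a b r| = 1 → s(a, r) ∈ ρ → s(b, r) ∈ ρ →
      Crosses s(p, q) s(a, r) ∧ 0 < orient p q r ∨ Crosses s(p, q) s(b, r) ∧ orient p q r < 0 ∨
        orient p q r = 0 := by
    intro r hr har hbr
    rcases crosses_triangle hr (hρ.subset har) (hρ.subset hbr) (hρ.subset hgρ) he hgx
      with h | h | h
    · have := ((crosses_iff he (hρ.subset har)).1 h).1
      exact Or.inl ⟨h, by nlinarith⟩
    · have := ((crosses_iff he (hρ.subset hbr)).1 h).1
      exact Or.inr (Or.inl ⟨h, by nlinarith⟩)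
    · exact Or.inr (Or.inr (hend r h))
  have hrange : ∀ r : ℤ × ℤ, |orient a b r| = 1 → s(a, r) ∈ ρ → s(b, r) ∈ ρ →
      orient p q a ≤ orient p q r ∧ orient p q r ≤ orient p q b := by
    intro r hr har hbr
    rcases hexit r hr har hbr with ⟨h, h'⟩ | ⟨h, h'⟩ | h
    · have := hmax' _ _ har h; omega
    · have := hmax' _ _ hbr h; omega
    · omega
  have hcr := hrange c (by rw [hc]; rfl) hac hbc
  have hdr := hrange d (by rw [hd']; rfl) had hbd
  have hL : 0 < (q.1 - p.1) ^ 2 + (q.2 - p.2) ^ 2 := by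
    by_contra! h
    have h1 : q.1 - p.1 = 0 := by nlinarith [sq_nonneg (q.1 - p.1), sq_nonneg (q.2 - p.2)]
    have h2 : q.2 - p.2 = 0 := by nlinarith [sq_nonneg (q.1 - p.1), sq_nonneg (q.2 - p.2)]
    exact (mem_latticeEdges.1 he).2.1 (Prod.ext (by omega) (by omega))
  -- A vertex `v` of `ab` at the height of `d` is strictly behind `d` in the direction of `pq`.
  have hahead : ∀ v : ℤ × ℤ, orient p q d = orient p q v → orient a b d - orient a b v = -1 →
      along p q v < along p q d := by
    intro v h1 h2
    have e : (along p q d - along p q v) * (orient p q b - orient p q a) =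
        ((q.1 - p.1) ^ 2 + (q.2 - p.2) ^ 2) * -(orient a b d - orient a b v)
        + (orient p q d - orient p q v) *
          ((b.1 - a.1) * (q.1 - p.1) + (b.2 - a.2) * (q.2 - p.2)) := by
      simp only [along, orient]; ring
    rw [h1, h2] at e
    by_contra! h
    nlinarith
  have hoa : orient a b a = 0 := by simp only [orient]; ring
  have hob : orient a b b = 0 := by simp only [orient]; ring
  -- Hence `d` lies strictly between the heights of `a` and `b`, by the choice of `ab`.
  have hda : orient p q d ≠ orient p q a := by
    intro h
    have h1 := hahead a h (by rw [hd', hoa]; rfl)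
    rcases hexit d (by rw [hd']; rfl) had hbd with ⟨-, h'⟩ | ⟨h2, h'⟩ | h'
    · omega
    · have := hmax' _ _ hbd h2; omega
    · omega
  have hdb : orient p q d ≠ orient p q b := by
    intro h
    have h1 := hahead b h (by rw [hd', hob]; rfl)
    rcases hexit d (by rw [hd']; rfl) had hbd with ⟨h2, h'⟩ | ⟨-, h'⟩ | h'
    · have := hmax' _ _ had h2; omega
    · omega
    · omega
  -- `c + d - 2a = k (b - a)`, and the heights force `k = 1`.
  obtain ⟨k, -, e1, e2⟩ := exists_opposite_apexes hc hd'
  have e3 : orient p q c + orient p q d - 2 * orient p q a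
      = k * (orient p q b - orient p q a) := by
    simp only [orient]
    linear_combination (q.1 - p.1) * e2 - (q.2 - p.2) * e1
  have hlt := lt_of_le_of_ne hdr.1 hda.symm
  have hlt' := lt_of_le_of_ne hdr.2 hdb
  have hk1 : k = 1 := by
    have h1 : 0 < k := by nlinarith
    have h2 : k < 2 := by nlinarith
    omega
  subst hk1
  have hadd : a + b = c + d := by
    ext
    · simp only [Prod.fst_add]; linarith
    · simp only [Prod.snd_add]; linarith
  have hflip : IsFlip ρ (insert s(c, d) (ρ.erase s(a, b))) a b c d :=
    ⟨hc, hadd, hgρ, hac, hbc, had, hbd, rfl⟩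
  refine ⟨a, b, c, d, _, hflip, hgx, ?_⟩
  have hcd : s(c, d) ∉ ρ.erase s(a, b) := fun h =>
    hρ.nonCrossing _ hgρ _ (Finset.mem_of_mem_erase h) (hflip.crosses hρ.subset)
  have hlt2 : span p q s(c, d) < span p q s(a, b) := by
    rw [span_mk, span_mk]; omega
  rw [crossingExtent, crossingExtent, Finset.sum_insert hcd, ← Finset.add_sum_erase _ _ hgρ,
    if_pos hgx.symm]
  split_ifs <;> omega

/-- `FlipPath T k σ τ`: the set `τ` arises from `σ` by `k` flips, none of which removes an edge
of `T`. -/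
inductive FlipPath (T : Finset (Sym2 (ℤ × ℤ))) :
    ℕ → Finset (Sym2 (ℤ × ℤ)) → Finset (Sym2 (ℤ × ℤ)) → Prop
  | refl (σ) : FlipPath T 0 σ σ
  | head {k σ τ υ a b c d} : IsFlip σ τ a b c d → s(a, b) ∉ T → FlipPath T k τ υ →
      FlipPath T (k + 1) σ υ

lemma FlipPath.trans {T σ τ υ : Finset (Sym2 (ℤ × ℤ))} {k l : ℕ} (h : FlipPath T k σ τ)
    (h' : FlipPath T l τ υ) : FlipPath T (k + l) σ υ := by
  induction h with
  | refl σ => simpa using h'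
  | head hf hT _ ih => rw [Nat.add_right_comm]; exact FlipPath.head hf hT (ih h')

lemma FlipPath.mem {T σ τ : Finset (Sym2 (ℤ × ℤ))} {k : ℕ} (h : FlipPath T k σ τ)
    {e : Sym2 (ℤ × ℤ)} (heT : e ∈ T) (he : e ∈ σ) : e ∈ τ := by
  induction h with
  | refl σ => exact he
  | head hf hT _ ih => exact ih (hf.mem_of_ne he fun h => hT (h ▸ heT))

lemma exists_flipPath_mem {m n : ℕ} {T : Finset (Sym2 (ℤ × ℤ))} (hT : T ⊆ latticeEdges m n)
    (hnc : NonCrossing T) {e : Sym2 (ℤ × ℤ)} (he : e ∈ T) {p q : ℤ × ℤ} (hpq : e = s(p, q)) :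
    ∀ (N : ℕ) (ρ : Finset (Sym2 (ℤ × ℤ))), IsTriangulation m n ρ → HasApexes m n ρ →
      crossingExtent p q ρ ≤ N →
      ∃ k ρ', k ≤ N ∧ FlipPath T k ρ ρ' ∧ IsTriangulation m n ρ' ∧ HasApexes m n ρ' ∧ e ∈ ρ' := by
  subst hpq
  intro N
  induction N with
  | zero =>
    intro ρ hρ hA hN
    refine ⟨0, ρ, le_rfl, .refl ρ, hρ, hA, (isTriangulation_iff.1 hρ).2.2 _ (hT he) ?_⟩
    intro g hg hx
    obtain ⟨a, b, c, d, ρ', -, -, h⟩ := exists_flip_crossingExtent_lt hρ hA (hT he) ⟨g, hg, hx⟩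
    omega
  | succ N ih =>
    intro ρ hρ hA hN
    by_cases hx : ∃ g ∈ ρ, Crosses s(p, q) g
    · obtain ⟨a, b, c, d, ρ', hf, hc, h⟩ := exists_flip_crossingExtent_lt hρ hA (hT he) hx
      obtain ⟨k, ρ'', hk, hp, h1, h2, h3⟩ := ih ρ' (hf.isTriangulation hρ) (hf.hasApexes hρ hA)
        (by omega)
      exact ⟨k + 1, ρ'', by omega, .head hf (fun h => hnc _ he _ h hc) hp, h1, h2, h3⟩
    · push Not at hx
      exact ⟨0, ρ, by omega, .refl ρ, hρ, hA, (isTriangulation_iff.1 hρ).2.2 _ (hT he) hx⟩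

lemma card_le_of_nonCrossing {m n : ℕ} {σ : Finset (Sym2 (ℤ × ℤ))} (hσ : σ ⊆ latticeEdges m n)
    (hnc : NonCrossing σ) : σ.card ≤ (2 * m + 1) * (2 * n + 1) := by
  have h : σ.card ≤ (Finset.Icc 0 (2 * (m : ℤ)) ×ˢ Finset.Icc 0 (2 * (n : ℤ))).card := by
    refine Finset.card_le_card_of_injOn doubleMid ?_ ?_
    · intro e he
      have he' := hσ he
      induction e using Sym2.ind with | _ a b =>
      obtain ⟨ha, hb⟩ := (mem_latticeEdges.1 he').1
      rw [mem_latticePoints] at ha hb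
      rw [Finset.mem_coe, Finset.mem_product, Finset.mem_Icc, Finset.mem_Icc]
      simp only [doubleMid, Sym2.lift_mk, Prod.fst_add, Prod.snd_add]
      omega
    · intro e he f hf h
      exact eq_of_doubleMid_eq (hnc e he f hf) h
  refine h.trans (le_of_eq ?_)
  rw [Finset.card_product, Int.card_Icc, Int.card_Icc]
  congr 1

lemma span_le {m n : ℕ} {p q : ℤ × ℤ} (hp : p ∈ latticePoints m n) (hq : q ∈ latticePoints m n)
    {g : Sym2 (ℤ × ℤ)} (hg : g ∈ latticeEdges m n) : span p q g ≤ 2 * (m * n) := by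
  induction g using Sym2.ind with | _ a b =>
  obtain ⟨ha, hb⟩ := (mem_latticeEdges.1 hg).1
  rw [mem_latticePoints] at hp hq ha hb
  have h1 : |(q.1 - p.1) * (a.2 - b.2)| ≤ m * n := by
    rw [abs_mul]
    exact mul_le_mul (abs_le.2 ⟨by omega, by omega⟩) (abs_le.2 ⟨by omega, by omega⟩)
      (abs_nonneg _) (by positivity)
  have h2 : |(q.2 - p.2) * (a.1 - b.1)| ≤ m * n := by
    rw [abs_mul, mul_comm (m : ℤ)]
    exact mul_le_mul (abs_le.2 ⟨by omega, by omega⟩) (abs_le.2 ⟨by omega, by omega⟩)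
      (abs_nonneg _) (by positivity)
  have h3 : orient p q a - orient p q b
      = (q.1 - p.1) * (a.2 - b.2) - (q.2 - p.2) * (a.1 - b.1) := by
    simp only [orient]; ring
  have h4 : |orient p q a - orient p q b| ≤ 2 * (m * n) := by
    rw [h3]
    exact (abs_sub _ _).trans (by linarith)
  rw [span_mk]
  rw [Int.abs_eq_natAbs] at h4
  exact_mod_cast h4

/-- A bound for the number of flips needed to insert one edge. -/
def insertionBound (m n : ℕ) : ℕ := (2 * m + 1) * (2 * n + 1) * (2 * (m * n))

lemma crossingExtent_le {m n : ℕ} {p q : ℤ × ℤ} (hp : p ∈ latticePoints m n)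
    (hq : q ∈ latticePoints m n) {ρ : Finset (Sym2 (ℤ × ℤ))} (hρ : IsTriangulation m n ρ) :
    crossingExtent p q ρ ≤ insertionBound m n := by
  classical
  rw [crossingExtent]
  calc _ ≤ ρ.card • (2 * (m * n)) := by
        refine Finset.sum_le_card_nsmul _ _ _ fun g hg => ?_
        split_ifs
        · exact span_le hp hq (hρ.subset hg)
        · exact Nat.zero_le _
    _ ≤ _ := by
        rw [smul_eq_mul, insertionBound]
        exact Nat.mul_le_mul_right _ (card_le_of_nonCrossing hρ.subset hρ.nonCrossing)

/-- Every triangulation with unimodular triangles can be flipped to one containing a given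
non-crossing set `T`, without ever removing an edge of `T`. -/
lemma exists_flipPath_subset {m n : ℕ} {T : Finset (Sym2 (ℤ × ℤ))} (hT : T ⊆ latticeEdges m n)
    (hnc : NonCrossing T) :
    ∀ (N : ℕ) (ρ : Finset (Sym2 (ℤ × ℤ))), IsTriangulation m n ρ → HasApexes m n ρ →
      (T \ ρ).card ≤ N →
      ∃ k ρ', k ≤ N * insertionBound m n ∧ FlipPath T k ρ ρ' ∧ IsTriangulation m n ρ' ∧
        HasApexes m n ρ' ∧ T ⊆ ρ' := by
  classical
  intro N
  induction N with
  | zero =>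
    intro ρ hρ hA hN
    exact ⟨0, ρ, by simp, .refl ρ, hρ, hA,
      Finset.sdiff_eq_empty_iff_subset.1 (Finset.card_eq_zero.1 (Nat.le_zero.1 hN))⟩
  | succ N ih =>
    intro ρ hρ hA hN
    by_cases hsub : T ⊆ ρ
    · exact ⟨0, ρ, by simp, .refl ρ, hρ, hA, hsub⟩
    obtain ⟨e, he, heρ⟩ := Finset.not_subset.1 hsub
    obtain ⟨⟨p, q⟩, hpq⟩ := e.exists_rep
    have hpq : e = s(p, q) := hpq.symm
    have hP := (mem_latticeEdges.1 (hpq ▸ hT he)).1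
    obtain ⟨k, ρ', hk, hpath, h1, h2, h3⟩ := exists_flipPath_mem hT hnc he hpq _ ρ hρ hA
      (crossingExtent_le hP.1 hP.2 hρ)
    have hcard : (T \ ρ').card ≤ N := by
      have : T \ ρ' ⊂ T \ ρ := by
        refine (Finset.ssubset_iff_of_subset fun f hf => ?_).2 ⟨e, by simp [he, heρ], by simp [h3]⟩
        rw [Finset.mem_sdiff] at hf ⊢
        exact ⟨hf.1, fun h => hf.2 (hpath.mem hf.1 h)⟩
      have := Finset.card_lt_card this
      omega
    obtain ⟨l, ρ'', hl, hpath', h1', h2', h3'⟩ := ih ρ' h1 h2 hcard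
    exact ⟨k + l, ρ'', by rw [Nat.succ_mul]; omega, hpath.trans hpath', h1', h2', h3'⟩

/-- Every triangulation is unimodular: flips lead to it from the standard triangulation. -/
lemma IsTriangulation.hasApexes {m n : ℕ} {σ : Finset (Sym2 (ℤ × ℤ))}
    (hσ : IsTriangulation m n σ) : HasApexes m n σ := by
  obtain ⟨k, ρ, -, -, h1, h2, h3⟩ := exists_flipPath_subset hσ.subset hσ.nonCrossing _ _
    (standardTriangulation_isTriangulation m n) (standardTriangulation_hasApexes m n) le_rfl
  rwa [Finset.Subset.antisymm h3 (hσ.le_of_ge h1.prop h3)]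

/-- A bound for the flip distance of two triangulations. -/
def flipBound (m n : ℕ) : ℕ := (2 * m + 1) * (2 * n + 1) * insertionBound m n

lemma exists_flipPath {m n : ℕ} {σ τ : Finset (Sym2 (ℤ × ℤ))} (hσ : IsTriangulation m n σ)
    (hτ : IsTriangulation m n τ) : ∃ k ≤ flipBound m n, FlipPath τ k σ τ := by
  obtain ⟨k, ρ, hk, hp, h1, h2, h3⟩ := exists_flipPath_subset hτ.subset hτ.nonCrossing _ _
    hσ hσ.hasApexes ((Finset.card_le_card Finset.sdiff_subset).trans
      (card_le_of_nonCrossing hτ.subset hτ.nonCrossing))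
  rw [← Finset.Subset.antisymm h3 (hτ.le_of_ge h1.prop h3)] at hp
  exact ⟨k, hk, hp⟩

/-! ### Pairs of flips -/

/-- Between triangulations, the flips of the dynamics are the flips of unimodular
parallelograms. -/
lemma flipAt_iff {m n : ℕ} {σ τ : Finset (Sym2 (ℤ × ℤ))} (hσ : IsTriangulation m n σ)
    (hτ : IsTriangulation m n τ) {x : ℤ × ℤ} :
    FlipAt x σ τ ↔ ∃ a b c d, doubleMid s(a, b) = x ∧ IsFlip σ τ a b c d := by
  constructor
  · rintro ⟨a, b, c, d, hx, hab, hac, hcb, hbd, hda, hcr, hins⟩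
    have hcd : s(c, d) ∈ τ := by rw [hins]; exact Finset.mem_insert_self _ _
    have hbc : s(b, c) ∈ σ := Sym2.eq_swap ▸ hcb
    have had : s(a, d) ∈ σ := Sym2.eq_swap ▸ hda
    clear hcb hda
    wlog hc : 0 < orient a b c generalizing c d
    · refine this d c had hbc (by rwa [Sym2.eq_swap (a := d)]) (by rwa [Sym2.eq_swap (a := d)])
        (by rwa [Sym2.eq_swap (a := d)]) hbd hac ?_
      have := ((crosses_iff (hσ.subset hab) (hτ.subset hcd)).1 hcr).1
      nlinarith
    have hd : orient a b d < 0 := by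
      have := ((crosses_iff (hσ.subset hab) (hτ.subset hcd)).1 hcr).1
      nlinarith
    -- the apexes of the two triangles of `σ` on `ab` are endpoints of `cd`
    have hapex : ∀ r, |orient a b r| = 1 → s(a, r) ∈ σ → s(b, r) ∈ σ → r = c ∨ r = d := by
      intro r hr har hbr
      have hrb : r ≠ a ∧ r ≠ b := by
        constructor <;> rintro rfl <;> simp [orient, mul_comm] at hr
      have hne : ∀ v, v = a ∨ v = b → s(v, r) ∈ σ → s(v, r) ∈ τ := by
        intro v hv hvr
        rw [hins]
        refine Finset.mem_insert_of_mem (Finset.mem_erase.2 ⟨fun h => ?_, hvr⟩)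
        have : r ∈ s(a, b) := h ▸ Sym2.mem_mk_right _ _
        rcases Sym2.mem_iff.1 this with h | h
        exacts [hrb.1 h, hrb.2 h]
      rcases crosses_triangle hr (hσ.subset har) (hσ.subset hbr) (hσ.subset hab) (hτ.subset hcd)
        hcr.symm with h | h | h
      · exact absurd h (hτ.nonCrossing _ hcd _ (hne a (Or.inl rfl) har))
      · exact absurd h (hτ.nonCrossing _ hcd _ (hne b (Or.inr rfl) hbr))
      · exact Sym2.mem_iff.1 h
    have hcP := (mem_latticeEdges.1 (hσ.subset hac)).1.2
    have hdP := (mem_latticeEdges.1 (hσ.subset had)).1.2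
    have hc1 : orient a b c = 1 := by
      obtain ⟨r, hr, har, hbr⟩ := hσ.hasApexes a b hab ⟨c, hcP, hc⟩
      rcases hapex r (by rw [hr]; rfl) har hbr with rfl | rfl
      · exact hr
      · omega
    have hd1 : orient a b d = -1 := by
      obtain ⟨r, hr, har, hbr⟩ := hσ.hasApexes b a (Sym2.eq_swap ▸ hab)
        ⟨d, hdP, by rw [orient_swap]; omega⟩
      rw [orient_swap] at hr
      rcases hapex r (by rw [abs_eq zero_le_one]; omega) hbr har with rfl | rfl
      · omega
      · omega
    -- `c + d - 2a = k (b - a)`, and `k = 1` because `cd` separates `a` and `b`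
    obtain ⟨k, hk, e1, e2⟩ := exists_opposite_apexes hc1 hd1
    have hsep := ((crosses_iff (hσ.subset hab) (hτ.subset hcd)).1 hcr).2
    have g1 : orient c d a = -k := by rw [hk]; simp only [orient]; ring
    have g2 : orient c d b = orient c d a + orient a b c - orient a b d := by
      simp only [orient]; ring
    rw [g2, g1, hc1, hd1] at hsep
    have hk1 : k = 1 := by
      have h1 : 0 < k := by by_contra! h; nlinarith
      have h2 : k < 2 := by by_contra! h; nlinarith
      omega
    subst hk1
    refine ⟨a, b, c, d, hx, hc1, ?_, hab, hac, hbc, had, hbd, hins⟩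
    ext
    · simp only [Prod.fst_add]; linarith
    · simp only [Prod.snd_add]; linarith
  · rintro ⟨a, b, c, d, hx, h⟩
    exact ⟨a, b, c, d, hx, h.mem, h.mem_ac, Sym2.eq_swap ▸ h.mem_bc, h.mem_bd,
      Sym2.eq_swap ▸ h.mem_ad, h.crosses hσ.subset, h.eq_insert⟩

namespace IsFlip

variable {m n : ℕ} {σ τ σ' τ' : Finset (Sym2 (ℤ × ℤ))} {a b c d a' b' c' d' : ℤ × ℤ}

/-- The flips of a triangulation at a given midpoint have the same result. -/
lemma unique (hσ : IsTriangulation m n σ) (h : IsFlip σ τ a b c d) (h' : IsFlip σ τ' a' b' c' d')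
    (hx : doubleMid s(a, b) = doubleMid s(a', b')) : τ = τ' := by
  have hab : s(a, b) = s(a', b') := eq_of_doubleMid_eq (hσ.nonCrossing _ h.mem _ h'.mem) hx
  have hnc := (h'.isTriangulation hσ).nonCrossing
  have hcr : Crosses s(c', d') s(a, b) := hab ▸ (h'.crosses hσ.subset).symm
  obtain ⟨-, hac, hbc, had, hbd, -⟩ := h.ne_points hσ.subset
  have hside : ∀ u v, (v ≠ a ∧ v ≠ b) → s(u, v) ∈ σ → ¬ Crosses s(c', d') s(u, v) := by
    intro u v hv huv
    refine hnc _ h'.cd_mem _ (h'.mem_of_ne huv fun he => ?_)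
    rw [← hab] at he
    rcases Sym2.mem_iff.1 (he ▸ Sym2.mem_mk_right u v : v ∈ s(a, b)) with h | h
    exacts [hv.1 h, hv.2 h]
  have hcd := h.eq_of_crosses hσ.subset (h'.cd_mem_latticeEdges hσ.subset) hcr
    (hside _ _ ⟨hac.symm, hbc.symm⟩ h.mem_ac) (hside _ _ ⟨hac.symm, hbc.symm⟩ h.mem_bc)
    (hside _ _ ⟨had.symm, hbd.symm⟩ h.mem_ad) (hside _ _ ⟨had.symm, hbd.symm⟩ h.mem_bd)
  rw [h.eq_insert, h'.eq_insert, hab, hcd]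

/-- The sides of the parallelogram `acbd`. -/
def IsSide (a b c d : ℤ × ℤ) (e : Sym2 (ℤ × ℤ)) : Prop :=
  e = s(a, c) ∨ e = s(b, c) ∨ e = s(a, d) ∨ e = s(b, d)

lemma isSide_of_triangle (hσ : IsTriangulation m n σ) (h : IsFlip σ τ a b c d) {x y r : ℤ × ℤ}
    (hr : |orient x y r| = 1) (hxy : s(x, y) ∈ σ) (hyr : s(y, r) ∈ σ) (hxr : s(x, r) = s(a, b)) :
    IsSide a b c d s(x, y) := by
  wlog hx : x = a ∧ r = b generalizing a b c d
  · rcases Sym2.eq_iff.1 hxr with h1 | h1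
    · exact absurd h1 hx
    · have := this h.swap (by rw [hxr, Sym2.eq_swap]) h1
      unfold IsSide at this ⊢
      tauto
  obtain ⟨rfl, rfl⟩ := hx
  rcases (abs_eq zero_le_one).1 hr with h1 | h1
  · have : y = d := apex_unique hσ.subset hσ.nonCrossing
      (by rw [← h1]; simp only [orient]; ring : orient r x y = 1)
      (by rw [orient_swap, h.orient_abd]; rfl) (Sym2.eq_swap ▸ hyr) hxy h.mem_bd h.mem_ad
    subst this
    exact Or.inr (Or.inr (Or.inl rfl))
  · have : y = c := apex_unique hσ.subset hσ.nonCrossing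
      (by rw [← neg_neg (1 : ℤ), ← h1]; simp only [orient]; ring : orient x r y = 1)
      h.orient_eq hxy (Sym2.eq_swap ▸ hyr) h.mem_ac h.mem_bc
    subst this
    exact Or.inl rfl

/-- Flips whose edges do not lie in a common triangle commute. -/
lemma commute (hσ : IsTriangulation m n σ) (h : IsFlip σ τ a b c d)
    (h' : IsFlip σ σ' a' b' c' d') (hne : doubleMid s(a', b') ≠ doubleMid s(a, b))
    (hs : ¬ IsSide a b c d s(a', b')) :
    ∃ τ', IsFlip τ τ' a' b' c' d' ∧ IsFlip σ' τ' a b c d := by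
  have hab : s(a', b') ≠ s(a, b) := ne_of_doubleMid hne
  have hba' : s(b', a') ∈ σ := Sym2.eq_swap ▸ h'.mem
  have hs' : ¬ IsSide a b c d s(b', a') := Sym2.eq_swap (a := a') ▸ hs
  have o1 := h'.orient_eq
  have o2 := h'.orient_abd
  have o3 : orient b' a' c' = -1 := by rw [orient_swap, o1]
  have o4 : orient b' a' d' = 1 := by rw [orient_swap, o2]; rfl
  have h1 : s(a', c') ≠ s(a, b) := fun hc =>
    hs (h.isSide_of_triangle hσ (by rw [o1]; rfl) h'.mem h'.mem_bc hc)
  have h2 : s(b', c') ≠ s(a, b) := fun hc =>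
    hs' (h.isSide_of_triangle hσ (by rw [o3]; rfl) hba' h'.mem_ac hc)
  have h3 : s(a', d') ≠ s(a, b) := fun hc =>
    hs (h.isSide_of_triangle hσ (by rw [o2]; rfl) h'.mem h'.mem_bd hc)
  have h4 : s(b', d') ≠ s(a, b) := fun hc =>
    hs' (h.isSide_of_triangle hσ (by rw [o4]; rfl) hba' h'.mem_ad hc)
  simp only [IsSide, not_or] at hs
  refine ⟨insert s(c', d') (τ.erase s(a', b')), ⟨o1, h'.add_eq, h.mem_of_ne h'.mem hab,
    h.mem_of_ne h'.mem_ac h1, h.mem_of_ne h'.mem_bc h2, h.mem_of_ne h'.mem_ad h3,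
    h.mem_of_ne h'.mem_bd h4, rfl⟩, ⟨h.orient_eq, h.add_eq, h'.mem_of_ne h.mem hab.symm,
    h'.mem_of_ne h.mem_ac (Ne.symm hs.1), h'.mem_of_ne h.mem_bc (Ne.symm hs.2.1),
    h'.mem_of_ne h.mem_ad (Ne.symm hs.2.2.1), h'.mem_of_ne h.mem_bd (Ne.symm hs.2.2.2), ?_⟩⟩
  have h5 : s(c, d) ≠ s(a', b') := ne_of_doubleMid (by rw [← h.mid_eq]; exact hne.symm)
  have h6 : s(c', d') ≠ s(a, b) := ne_of_doubleMid (by rw [← h'.mid_eq]; exact hne)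
  rw [h.eq_insert, h'.eq_insert, Finset.erase_insert_of_ne h5, Finset.erase_insert_of_ne h6,
    Finset.insert_comm, Finset.erase_right_comm]

/-- If the edge `xy` lies in the triangle `xyv` of `σ`, which a flip replaces by the triangle
`xyw`, then it cannot be flipped both before and after: the triangle on its other side would be
the reflection of both. -/
lemma not_flip_both_aux (hσ : IsTriangulation m n σ) (h : IsFlip σ τ a b c d) {x y v w : ℤ × ℤ}
    (hv : orient x y v = -1) (hw : orient x y w = -1) (hxv : s(x, v) ∈ σ) (hyv : s(y, v) ∈ σ)
    (hxw : s(x, w) ∈ τ) (hyw : s(y, w) ∈ τ) (hvw : v ≠ w)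
    (hab : s(a, b) = s(x, v) ∨ s(a, b) = s(y, v))
    (h1 : IsFlip σ σ' x y c' d') {c'' d'' : ℤ × ℤ} (h2 : IsFlip τ τ' x y c'' d'') : False := by
  have hτ := h.isTriangulation hσ
  have hxy : x ≠ y := by rintro rfl; simp [orient] at hv
  have hyv' : y ≠ v := by rintro rfl; simp [orient, mul_comm] at hv
  have hxv' : x ≠ v := by rintro rfl; simp [orient] at hv
  have e1 : v = d' := apex_unique hσ.subset hσ.nonCrossing (by rw [orient_swap, hv]; rfl)
    (by rw [orient_swap, h1.orient_abd]; rfl) hyv hxv h1.mem_bd h1.mem_ad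
  have e2 : w = d'' := apex_unique hτ.subset hτ.nonCrossing (by rw [orient_swap, hw]; rfl)
    (by rw [orient_swap, h2.orient_abd]; rfl) hyw hxw h2.mem_bd h2.mem_ad
  have hcv : c' ≠ v := by rintro rfl; have := h1.orient_eq; omega
  have m1 : s(x, c') ≠ s(a, b) := by
    rintro he
    rcases hab with hab | hab <;> rw [hab] at he <;> rcases Sym2.eq_iff.1 he with h | h <;> simp_all
  have m2 : s(y, c') ≠ s(a, b) := by
    rintro he
    rcases hab with hab | hab <;> rw [hab] at he <;> rcases Sym2.eq_iff.1 he with h | h <;> simp_all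
  have e3 : c' = c'' := apex_unique hτ.subset hτ.nonCrossing h1.orient_eq h2.orient_eq
    (h.mem_of_ne h1.mem_ac m1) (h.mem_of_ne h1.mem_bc m2) h2.mem_ac h2.mem_bc
  apply hvw
  have := h1.add_eq.symm.trans h2.add_eq
  rw [e3] at this
  rw [e1, e2]
  exact add_left_cancel this

lemma exists_of_eq (h : IsFlip σ τ a b c d) {x y : ℤ × ℤ} (hxy : s(a, b) = s(x, y)) :
    ∃ c' d', IsFlip σ τ x y c' d' := by
  rcases Sym2.eq_iff.1 hxy with ⟨rfl, rfl⟩ | ⟨rfl, rfl⟩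
  · exact ⟨_, _, h⟩
  · exact ⟨_, _, h.swap⟩

/-- A side of the parallelogram of a flip cannot be flipped both before and after the flip. -/
lemma not_flip_both (hσ : IsTriangulation m n σ) (h : IsFlip σ τ a b c d)
    (h1 : IsFlip σ σ' a' b' c' d') (hs : IsSide a b c d s(a', b')) {c'' d'' : ℤ × ℤ}
    (h2 : IsFlip τ τ' a' b' c'' d'') : False := by
  wlog hs' : s(a', b') = s(a, c) ∨ s(a', b') = s(c, b) generalizing a b c d
  · refine this h.swap ?_ ?_
    · unfold IsSide at hs ⊢; tauto
    · rw [Sym2.eq_swap (a := d)]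
      rw [Sym2.eq_swap (a := c)] at hs'
      unfold IsSide at hs
      tauto
  have h' := h.symm hσ
  obtain ⟨hab, hac, hbc, had, hbd, hcd⟩ := h.ne_points hσ.subset
  rcases hs' with he | he
  · obtain ⟨_, _, k1⟩ := h1.exists_of_eq he
    obtain ⟨_, _, k2⟩ := h2.exists_of_eq he
    refine h.not_flip_both_aux hσ (v := b) (w := d) ?_ ?_ h.mem (Sym2.eq_swap ▸ h.mem_bc)
      (Sym2.eq_swap ▸ h'.mem_bd) h.cd_mem hbd (Or.inl rfl) k1 k2
    · rw [← h.orient_eq]; simp only [orient]; ring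
    · rw [orient_rotate, ← h.orient_cda]; simp only [orient]; ring
  · obtain ⟨_, _, k1⟩ := h1.exists_of_eq he
    obtain ⟨_, _, k2⟩ := h2.exists_of_eq he
    refine h.not_flip_both_aux hσ (v := a) (w := d) ?_ ?_ (Sym2.eq_swap ▸ h.mem_ac)
      (Sym2.eq_swap ▸ h.mem) h.cd_mem (Sym2.eq_swap ▸ h'.mem_bc) had
      (Or.inr Sym2.eq_swap) k1 k2
    · rw [← h.orient_eq]; simp only [orient]; ring
    · rw [← h.orient_cdb]; simp only [orient]; ring

end IsFlip

/-! ### Lengths and acceptance probabilities -/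

lemma edgeLength_mk (a b : ℤ × ℤ) :
    edgeLength s(a, b) = (a.1 - b.1).natAbs + (a.2 - b.2).natAbs := rfl

lemma edgeLength_pos {a b : ℤ × ℤ} (h : a ≠ b) : 0 < edgeLength s(a, b) := by
  rw [edgeLength_mk]
  by_contra! h'
  exact h (Prod.ext (by omega) (by omega))

lemma edgeLength_le {m n : ℕ} {e : Sym2 (ℤ × ℤ)} (he : e ∈ latticeEdges m n) :
    edgeLength e ≤ m + n := by
  induction e using Sym2.ind with | _ a b =>
  obtain ⟨ha, hb⟩ := (mem_latticeEdges.1 he).1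
  rw [mem_latticePoints] at ha hb
  rw [edgeLength_mk]
  omega

namespace IsFlip

variable {m n : ℕ} {σ τ : Finset (Sym2 (ℤ × ℤ))} {a b c d : ℤ × ℤ}

lemma edgeLength_bd (h : IsFlip σ τ a b c d) : edgeLength s(b, d) = edgeLength s(a, c) := by
  have h1 := h.fst_eq
  have h2 := h.snd_eq
  rw [edgeLength_mk, edgeLength_mk]
  omega

lemma edgeLength_bc (h : IsFlip σ τ a b c d) : edgeLength s(b, c) = edgeLength s(a, d) := by
  have h1 := h.fst_eq
  have h2 := h.snd_eq
  rw [edgeLength_mk, edgeLength_mk]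
  omega

/-- The longer diagonal of a unimodular parallelogram is as long as two adjacent sides together:
the sides lie in a common closed quadrant, up to a change of orientation. -/
lemma add_le_max_edgeLength (h : IsFlip σ τ a b c d) :
    edgeLength s(a, c) + edgeLength s(a, d) ≤ max (edgeLength s(a, b)) (edgeLength s(c, d)) := by
  have h1 := h.fst_eq
  have h2 := h.snd_eq
  obtain ⟨x, hx⟩ : ∃ x, x = c.1 - a.1 := ⟨_, rfl⟩
  obtain ⟨y, hy⟩ : ∃ y, y = c.2 - a.2 := ⟨_, rfl⟩
  obtain ⟨z, hz⟩ : ∃ z, z = b.1 - c.1 := ⟨_, rfl⟩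
  obtain ⟨w, hw⟩ : ∃ w, w = b.2 - c.2 := ⟨_, rfl⟩
  have hdet : z * y - w * x = 1 := by
    rw [← h.orient_eq, hx, hy, hz, hw]; simp only [orient]; ring
  have hsign : 0 ≤ (x * z) * (y * w) := by
    have e : (x * z) * (y * w) = (w * x) * (w * x + 1) := by rw [← hdet]; ring
    rw [e]
    rcases le_or_gt 0 (w * x) with h | h
    · positivity
    · nlinarith
  simp only [edgeLength_mk]
  rcases mul_nonneg_iff.1 hsign with ⟨k1, k2⟩ | ⟨k1, k2⟩
  · refine le_max_of_le_left ?_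
    rcases mul_nonneg_iff.1 k1 with k1 | k1 <;> rcases mul_nonneg_iff.1 k2 with k2 | k2 <;> omega
  · refine le_max_of_le_right ?_
    rcases mul_nonpos_iff.1 k1 with k1 | k1 <;> rcases mul_nonpos_iff.1 k2 with k2 | k2 <;> omega

lemma totalLength_add (hσ : σ ⊆ latticeEdges m n) (hnc : NonCrossing σ)
    (h : IsFlip σ τ a b c d) :
    totalLength τ + edgeLength s(a, b) = totalLength σ + edgeLength s(c, d) := by
  have hcd : s(c, d) ∉ σ.erase s(a, b) := fun hc =>
    hnc _ h.mem _ (Finset.mem_of_mem_erase hc) (h.crosses hσ)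
  rw [totalLength, totalLength, h.eq_insert, Finset.sum_insert hcd,
    ← Finset.sum_erase_add _ _ h.mem]
  ring

end IsFlip

/-- The heat-bath probability of replacing an edge of length `i` by one of length `j`. -/
noncomputable def acceptProb (lam : ℝ) (i j : ℕ) : ℝ := lam ^ j / (lam ^ j + lam ^ i)

lemma acceptProb_nonneg {lam : ℝ} (h : 0 < lam) (i j : ℕ) : 0 ≤ acceptProb lam i j := by
  unfold acceptProb; positivity

lemma acceptProb_add {lam : ℝ} (h : 0 < lam) (i j : ℕ) :
    acceptProb lam i j + acceptProb lam j i = 1 := by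
  have h1 : 0 < lam ^ i := by positivity
  have h2 : 0 < lam ^ j := by positivity
  unfold acceptProb
  field_simp
  ring

lemma acceptProb_le_one {lam : ℝ} (h : 0 < lam) (i j : ℕ) : acceptProb lam i j ≤ 1 := by
  linarith [acceptProb_add h i j, acceptProb_nonneg h j i]

/-- The small probability of a lengthening flip outweighs the growth of its weight. -/
lemma acceptProb_mul_pow_le {lam : ℝ} (h : 0 < lam) (h' : lam ≤ 1 / 8) (i j : ℕ) :
    acceptProb lam i j * 5 ^ max i j ≤ 5 ^ i := by
  rcases le_total j i with hji | hij
  · rw [max_eq_left hji]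
    exact mul_le_of_le_one_left (by positivity) (acceptProb_le_one h i j)
  · obtain ⟨k, rfl⟩ := Nat.exists_eq_add_of_le hij
    rw [max_eq_right hij]
    have h1 : acceptProb lam i (i + k) ≤ lam ^ k := by
      have hi : 0 < lam ^ i := by positivity
      have hk : 0 < lam ^ (i + k) := by positivity
      rw [acceptProb, div_le_iff₀ (by positivity), pow_add]
      have : 0 < lam ^ k := by positivity
      nlinarith [mul_pos this (mul_pos hi this)]
    calc acceptProb lam i (i + k) * 5 ^ (i + k) ≤ lam ^ k * 5 ^ (i + k) := by gcongr
      _ = 5 ^ i * (5 * lam) ^ k := by rw [pow_add, mul_pow]; ring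
      _ ≤ 5 ^ i * 1 := by
          gcongr
          exact pow_le_one₀ (by positivity) (by linarith)
      _ = 5 ^ i := mul_one _

/-! ### The generator of the dynamics -/

section Dynamics

variable {m n : ℕ} {η : Finset (Sym2 (ℤ × ℤ))} {lam : ℝ}

lemma mem_triangulations {σ : Finset (Sym2 (ℤ × ℤ))} :
    σ ∈ triangulations m n η ↔ IsTriangulation m n σ ∧ η ⊆ σ := by
  simp only [triangulations, Finset.mem_filter, Finset.mem_powerset]
  exact ⟨fun h => h.2, fun h => ⟨h.1.subset, h⟩⟩

lemma State.isTriangulation (σ : State m n η) : IsTriangulation m n σ.1 :=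
  (mem_triangulations.1 σ.2).1

lemma State.subset (σ : State m n η) : η ⊆ σ.1 := (mem_triangulations.1 σ.2).2

lemma IsFlip.mem_triangulations_of_notMem {σ τ : Finset (Sym2 (ℤ × ℤ))} {a b c d : ℤ × ℤ}
    (hσ : σ ∈ triangulations m n η) (h : IsFlip σ τ a b c d) (hab : s(a, b) ∉ η) :
    τ ∈ triangulations m n η := by
  rw [mem_triangulations] at hσ ⊢
  exact ⟨h.isTriangulation hσ.1, fun e he => h.mem_of_ne (hσ.2 he) fun h' => hab (h' ▸ he)⟩

lemma notMem_of_mem_freeMidpoints {e : Sym2 (ℤ × ℤ)} (h : doubleMid e ∈ freeMidpoints m n η) :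
    e ∉ η := fun he =>
  (Finset.mem_sdiff.1 h).2 (Finset.mem_image_of_mem _ he)

lemma IsFlip.mem_freeMidpoints {σ τ : State m n η} {a b c d : ℤ × ℤ}
    (h : IsFlip σ.1 τ.1 a b c d) : doubleMid s(a, b) ∈ freeMidpoints m n η := by
  have hσ := σ.isTriangulation
  refine Finset.mem_sdiff.2 ⟨Finset.mem_filter.2 ⟨?_, ?_⟩, ?_⟩
  · obtain ⟨ha, hb⟩ := (mem_latticeEdges.1 (hσ.subset h.mem)).1
    rw [mem_latticePoints] at ha hb
    rw [Finset.mem_product, Finset.mem_Icc, Finset.mem_Icc]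
    simp only [doubleMid, Sym2.lift_mk, Prod.fst_add, Prod.snd_add]
    omega
  · rintro ⟨⟨k, hk⟩, l, hl⟩
    simp only [doubleMid, Sym2.lift_mk, Prod.fst_add, Prod.snd_add] at hk hl
    have h1 := h.orient_eq
    have e1 : b.1 - a.1 = 2 * (k - a.1) := by omega
    have e2 : b.2 - a.2 = 2 * (l - a.2) := by omega
    simp only [orient] at h1
    rw [e1, e2, mul_assoc, mul_assoc] at h1
    omega
  · intro hx
    obtain ⟨e, he, hm⟩ := Finset.mem_image.1 hx
    have : e = s(a, b) :=
      eq_of_doubleMid_eq (hσ.nonCrossing _ (σ.subset he) _ h.mem) hm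
    subst this
    exact τ.isTriangulation.nonCrossing _ (τ.subset he) _ h.cd_mem (h.crosses hσ.subset)

lemma gibbs_div (hlam : 0 < lam) (σ τ : State m n η) :
    gibbs m n η lam τ / (gibbs m n η lam τ + gibbs m n η lam σ)
      = acceptProb lam (totalLength σ.1) (totalLength τ.1) := by
  have hZ : 0 < ∑ τ : State m n η, lam ^ totalLength τ.1 :=
    Finset.sum_pos (fun _ _ => by positivity) ⟨σ, Finset.mem_univ _⟩
  rw [gibbs, gibbs, acceptProb, ← add_div, div_div_div_cancel_right₀ hZ.ne']

lemma IsFlip.acceptProb_eq (hlam : 0 < lam) {σ τ : State m n η} {a b c d : ℤ × ℤ}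
    (h : IsFlip σ.1 τ.1 a b c d) :
    acceptProb lam (totalLength σ.1) (totalLength τ.1)
      = acceptProb lam (edgeLength s(a, b)) (edgeLength s(c, d)) := by
  have h1 := h.totalLength_add σ.isTriangulation.subset σ.isTriangulation.nonCrossing
  have h2 := congrArg (fun k => lam ^ k) h1
  simp only [pow_add] at h2
  have p1 : 0 < lam ^ totalLength σ.1 := by positivity
  have p2 : 0 < lam ^ totalLength τ.1 := by positivity
  have p3 : 0 < lam ^ edgeLength s(a, b) := by positivity
  have p4 : 0 < lam ^ edgeLength s(c, d) := by positivity
  rw [acceptProb, acceptProb, div_eq_div_iff (by positivity) (by positivity)]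
  linear_combination h2

open Classical in
/-- The expected change of `f` when the edge of `σ` with midpoint `x` is updated. -/
noncomputable def drift (lam : ℝ) (x : ℤ × ℤ) (f : State m n η → ℝ) (σ : State m n η) : ℝ :=
  ∑ τ : State m n η, if FlipAt x σ.1 τ.1 then
    acceptProb lam (totalLength σ.1) (totalLength τ.1) * (f τ - f σ) else 0

lemma IsFlip.drift_eq (hlam : 0 < lam) {σ τ : State m n η} {a b c d : ℤ × ℤ}
    (h : IsFlip σ.1 τ.1 a b c d) {x : ℤ × ℤ} (hx : doubleMid s(a, b) = x)
    (f : State m n η → ℝ) :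
    drift lam x f σ = acceptProb lam (edgeLength s(a, b)) (edgeLength s(c, d)) * (f τ - f σ) := by
  classical
  have hσ := σ.isTriangulation
  rw [drift, Finset.sum_eq_single τ, if_pos, h.acceptProb_eq hlam]
  · exact (flipAt_iff hσ τ.isTriangulation).2 ⟨a, b, c, d, hx, h⟩
  · intro τ' _ hne
    rw [if_neg]
    intro hf
    obtain ⟨a', b', c', d', hx', h'⟩ := (flipAt_iff hσ τ'.isTriangulation).1 hf
    exact hne (Subtype.ext (h'.unique hσ h (hx'.trans hx.symm)))
  · simp

lemma drift_eq_zero {σ : State m n η} {x : ℤ × ℤ}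
    (h : ∀ (τ : State m n η) (a b c d : ℤ × ℤ), doubleMid s(a, b) = x →
      ¬ IsFlip σ.1 τ.1 a b c d) (f : State m n η → ℝ) : drift lam x f σ = 0 := by
  classical
  refine Finset.sum_eq_zero fun τ _ => if_neg fun hf => ?_
  obtain ⟨a, b, c, d, hx, h'⟩ := (flipAt_iff σ.isTriangulation τ.isTriangulation).1 hf
  exact h τ a b c d hx h'

lemma glauber_mulVec (hlam : 0 < lam) (f : State m n η → ℝ) (σ : State m n η) :
    (glauber m n η lam).mulVec f σ =
      f σ + ((freeMidpoints m n η).card : ℝ)⁻¹ * ∑ x ∈ freeMidpoints m n η, drift lam x f σ := by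
  classical
  have h1 : (glauber m n η lam).mulVec f σ =
      f σ + ∑ τ : State m n η, moveProb m n η lam σ τ * (f τ - f σ) := by
    rw [Matrix.mulVec, dotProduct, ← Finset.add_sum_erase _ _ (Finset.mem_univ σ),
      ← Finset.add_sum_erase Finset.univ (fun τ => moveProb m n η lam σ τ * (f τ - f σ))
        (Finset.mem_univ σ)]
    have h2 : ∑ τ ∈ Finset.univ.erase σ, glauber m n η lam σ τ * f τ
        = ∑ τ ∈ Finset.univ.erase σ, moveProb m n η lam σ τ * f τ := by
      refine Finset.sum_congr rfl fun τ hτ => ?_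
      rw [glauber, if_neg (Finset.ne_of_mem_erase hτ)]
    rw [h2, glauber, if_pos rfl]
    simp only [mul_sub, Finset.sum_sub_distrib, ← Finset.sum_mul]
    ring
  rw [h1]
  congr 1
  rw [Finset.mul_sum]
  simp only [moveProb, drift, Finset.sum_mul, Finset.mul_sum]
  rw [Finset.sum_comm]
  refine Finset.sum_congr rfl fun x _ => Finset.sum_congr rfl fun τ _ => ?_
  rw [gibbs_div hlam]
  split_ifs <;> ring

/-- The weighted Lipschitz condition: a flip between edges of lengths `i` and `j` changes `f` by
at most `K * 5 ^ max i j`. The base `5` satisfies `5 λ ≤ 1`, so that lengthening flips have small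
expected weight, and `4 / 5 < 1`, so that the four sides of a parallelogram weigh less than its
longer diagonal. -/
def FlipLipschitz (K : ℝ) (f : State m n η → ℝ) : Prop :=
  ∀ (σ τ : State m n η) (a b c d : ℤ × ℤ), IsFlip σ.1 τ.1 a b c d →
    |f σ - f τ| ≤ K * 5 ^ max (edgeLength s(a, b)) (edgeLength s(c, d))

/-- The expected change at a flippable midpoint is at most the weight of the edge there. -/
lemma abs_drift_le (hlam : 0 < lam) (hlam' : lam ≤ 1 / 8) {K : ℝ} (hK : 0 ≤ K)
    {f : State m n η → ℝ} (hf : FlipLipschitz K f) {σ : State m n η} {e : Sym2 (ℤ × ℤ)}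
    (he : e ∈ σ.1) : |drift lam (doubleMid e) f σ| ≤ K * 5 ^ edgeLength e := by
  by_cases h : ∃ (τ : State m n η) (a b c d : ℤ × ℤ), doubleMid s(a, b) = doubleMid e ∧
      IsFlip σ.1 τ.1 a b c d
  · obtain ⟨τ, a, b, c, d, hx, h⟩ := h
    have hab : s(a, b) = e :=
      eq_of_doubleMid_eq (σ.isTriangulation.nonCrossing _ h.mem _ he) hx
    rw [h.drift_eq hlam hx, abs_mul, abs_of_nonneg (acceptProb_nonneg hlam _ _), ← hab,
      abs_sub_comm]
    calc _ ≤ acceptProb lam (edgeLength s(a, b)) (edgeLength s(c, d)) *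
          (K * 5 ^ max (edgeLength s(a, b)) (edgeLength s(c, d))) := by
          gcongr
          · exact acceptProb_nonneg hlam _ _
          · exact hf _ _ _ _ _ _ h
      _ = K * (acceptProb lam (edgeLength s(a, b)) (edgeLength s(c, d)) *
          5 ^ max (edgeLength s(a, b)) (edgeLength s(c, d))) := by ring
      _ ≤ _ := by
          gcongr
          exact acceptProb_mul_pow_le hlam hlam' _ _
  · push Not at h
    rw [drift_eq_zero h, abs_zero]
    positivity

/-- Bound for the contribution of the update at `y` to the change of `f σ - f τ`, where `σ` and
`τ` differ by a flip of `ab` to `cd`. -/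
noncomputable def siteBound (a b c d : ℤ × ℤ) (y : ℤ × ℤ) : ℝ :=
  (if y = doubleMid s(a, b) then 0
    else 5 ^ max (edgeLength s(a, b)) (edgeLength s(c, d)))
  + ((if y = doubleMid s(a, c) then 5 ^ edgeLength s(a, c) else 0)
  + (if y = doubleMid s(b, c) then 5 ^ edgeLength s(b, c) else 0)
  + (if y = doubleMid s(a, d) then 5 ^ edgeLength s(a, d) else 0)
  + (if y = doubleMid s(b, d) then 5 ^ edgeLength s(b, d) else 0))

lemma IsFlip.add_le_siteBound {σ τ : State m n η} {a b c d : ℤ × ℤ}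
    (h : IsFlip σ.1 τ.1 a b c d) {e : Sym2 (ℤ × ℤ)} (he : IsFlip.IsSide a b c d e) :
    5 ^ max (edgeLength s(a, b)) (edgeLength s(c, d)) + 5 ^ edgeLength e
      ≤ siteBound a b c d (doubleMid e) := by
  have hσ := σ.isTriangulation
  obtain ⟨hab, hac, hbc, had, hbd, hcd⟩ := h.ne_points hσ.subset
  have hne : doubleMid e ≠ doubleMid s(a, b) := by
    intro hm
    have heσ : e ∈ σ.1 := by
      rcases he with rfl | rfl | rfl | rfl
      exacts [h.mem_ac, h.mem_bc, h.mem_ad, h.mem_bd]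
    have he' := eq_of_doubleMid_eq (hσ.nonCrossing _ heσ _ h.mem) hm
    rcases he with rfl | rfl | rfl | rfl <;> rcases Sym2.eq_iff.1 he' with h | h <;> simp_all
  rw [siteBound, if_neg hne]
  gcongr
  have hnn : ∀ (p : Prop) [Decidable p] (k : ℕ), (0 : ℝ) ≤ if p then 5 ^ k else 0 := by
    intro p _ k; split_ifs <;> positivity
  have n1 := hnn (doubleMid e = doubleMid s(a, c)) (edgeLength s(a, c))
  have n2 := hnn (doubleMid e = doubleMid s(b, c)) (edgeLength s(b, c))
  have n3 := hnn (doubleMid e = doubleMid s(a, d)) (edgeLength s(a, d))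
  have n4 := hnn (doubleMid e = doubleMid s(b, d)) (edgeLength s(b, d))
  have hpos : ∀ g, e = g → (if doubleMid e = doubleMid g then (5 : ℝ) ^ edgeLength g else 0)
      = 5 ^ edgeLength e := by
    rintro g rfl; exact if_pos rfl
  rcases he with he | he | he | he <;> have := hpos _ he <;> linarith

lemma le_siteBound {a b c d y : ℤ × ℤ} (hy : y ≠ doubleMid s(a, b)) :
    (5 : ℝ) ^ max (edgeLength s(a, b)) (edgeLength s(c, d)) ≤ siteBound a b c d y := by
  rw [siteBound, if_neg hy]
  refine le_add_of_nonneg_right ?_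
  have hnn : ∀ (p : Prop) [Decidable p] (k : ℕ), (0 : ℝ) ≤ if p then 5 ^ k else 0 := by
    intro p _ k; split_ifs <;> positivity
  exact add_nonneg (add_nonneg (add_nonneg (hnn _ _) (hnn _ _)) (hnn _ _)) (hnn _ _)

lemma siteBound_nonneg (a b c d y : ℤ × ℤ) : 0 ≤ siteBound a b c d y := by
  unfold siteBound
  positivity

/-- The update at `x` does not depend on which of the two edges at `x` is present. -/
lemma IsFlip.add_drift_eq (hlam : 0 < lam) {σ τ : State m n η} {a b c d : ℤ × ℤ}
    (h : IsFlip σ.1 τ.1 a b c d) (f : State m n η → ℝ) :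
    f σ + drift lam (doubleMid s(a, b)) f σ = f τ + drift lam (doubleMid s(a, b)) f τ := by
  rw [h.drift_eq hlam rfl, (h.symm σ.isTriangulation).drift_eq hlam h.mid_eq.symm,
    Sym2.eq_swap (a := b)]
  linear_combination (f τ - f σ) * acceptProb_add hlam (edgeLength s(a, b)) (edgeLength s(c, d))

/-- If the edge at `y` can be flipped in `σ` and is not a side of the parallelogram at `x`, the
updates at `y` in `σ` and `τ` are coupled. -/
lemma IsFlip.abs_add_drift_le_of_commute (hlam : 0 < lam) {K : ℝ} {f : State m n η → ℝ}
    (hf : FlipLipschitz K f) {σ τ σ' : State m n η} {a b c d a' b' c' d' : ℤ × ℤ}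
    (h : IsFlip σ.1 τ.1 a b c d) (h' : IsFlip σ.1 σ'.1 a' b' c' d')
    (hne : doubleMid s(a', b') ≠ doubleMid s(a, b))
    (hs : ¬ IsFlip.IsSide a b c d s(a', b')) :
    |f σ + drift lam (doubleMid s(a', b')) f σ - (f τ + drift lam (doubleMid s(a', b')) f τ)|
      ≤ K * 5 ^ max (edgeLength s(a, b)) (edgeLength s(c, d)) := by
  obtain ⟨τ', h1, h2⟩ := h.commute σ.isTriangulation h' hne hs
  have hτ' : τ' ∈ triangulations m n η := h1.mem_triangulations_of_notMem τ.2
    (notMem_of_mem_freeMidpoints h'.mem_freeMidpoints)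
  rw [h'.drift_eq hlam rfl, IsFlip.drift_eq (τ := ⟨τ', hτ'⟩) hlam h1 rfl]
  have e1 := hf _ _ _ _ _ _ h
  have e2 := hf σ' ⟨τ', hτ'⟩ _ _ _ _ h2
  have p0 := acceptProb_nonneg hlam (edgeLength s(a', b')) (edgeLength s(c', d'))
  have p1 := acceptProb_le_one hlam (edgeLength s(a', b')) (edgeLength s(c', d'))
  rw [abs_le] at e1 e2 ⊢
  constructor <;> nlinarith

lemma IsFlip.abs_add_drift_le (hlam : 0 < lam) (hlam' : lam ≤ 1 / 8) {K : ℝ} (hK : 0 ≤ K)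
    {f : State m n η → ℝ} (hf : FlipLipschitz K f) {σ τ : State m n η} {a b c d : ℤ × ℤ}
    (h : IsFlip σ.1 τ.1 a b c d) (y : ℤ × ℤ) :
    |f σ + drift lam y f σ - (f τ + drift lam y f τ)| ≤ K * siteBound a b c d y := by
  have hσ := σ.isTriangulation
  have hsym := h.symm hσ
  by_cases hy : y = doubleMid s(a, b)
  · rw [hy, h.add_drift_eq hlam, sub_self, abs_zero]
    exact mul_nonneg hK (siteBound_nonneg _ _ _ _ _)
  have hw := hf _ _ _ _ _ _ h
  have hbase := mul_le_mul_of_nonneg_left (le_siteBound (c := c) (d := d) hy) hK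
  by_cases hside : ∃ e, IsFlip.IsSide a b c d e ∧ y = doubleMid e
  · obtain ⟨e, he, rfl⟩ := hside
    have heσ : e ∈ σ.1 := by
      rcases he with rfl | rfl | rfl | rfl
      exacts [h.mem_ac, h.mem_bc, h.mem_ad, h.mem_bd]
    have heτ : e ∈ τ.1 := h.mem_of_ne heσ (IsFlip.ne_of_doubleMid hy)
    have hsb := mul_le_mul_of_nonneg_left (h.add_le_siteBound he) hK
    rw [mul_add] at hsb
    -- at most one of the two drifts does not vanish
    by_cases h1 : ∃ (σ' : State m n η) (a' b' c' d' : ℤ × ℤ), doubleMid s(a', b') = doubleMid e ∧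
        IsFlip σ.1 σ'.1 a' b' c' d'
    · obtain ⟨σ', a', b', c', d', hx, h1⟩ := h1
      have hae : s(a', b') = e := eq_of_doubleMid_eq (hσ.nonCrossing _ h1.mem _ heσ) hx
      have hz : drift lam (doubleMid e) f τ = 0 := by
        refine drift_eq_zero (fun τ' a'' b'' c'' d'' hx' h2 => ?_) f
        have hae' : s(a'', b'') = s(a', b') := hae.symm ▸
          eq_of_doubleMid_eq (τ.isTriangulation.nonCrossing _ h2.mem _ heτ) hx'
        obtain ⟨_, _, h2'⟩ := h2.exists_of_eq hae'
        exact h.not_flip_both hσ h1 (hae.symm ▸ he) h2'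
      rw [hz]
      have := abs_drift_le hlam hlam' hK hf heσ
      rw [abs_le] at *
      constructor <;> linarith
    · push Not at h1
      rw [drift_eq_zero h1]
      have := abs_drift_le hlam hlam' hK hf heτ
      rw [abs_le] at *
      constructor <;> linarith
  · push Not at hside
    refine le_trans ?_ hbase
    by_cases h1 : ∃ (σ' : State m n η) (a' b' c' d' : ℤ × ℤ), doubleMid s(a', b') = y ∧
        IsFlip σ.1 σ'.1 a' b' c' d'
    · obtain ⟨σ', a', b', c', d', rfl, h1⟩ := h1
      exact h.abs_add_drift_le_of_commute hlam hf h1 hy fun hs => hside _ hs rfl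
    · by_cases h2 : ∃ (τ' : State m n η) (a' b' c' d' : ℤ × ℤ), doubleMid s(a', b') = y ∧
        IsFlip τ.1 τ'.1 a' b' c' d'
      · obtain ⟨τ', a', b', c', d', rfl, h2⟩ := h2
        rw [abs_sub_comm, max_comm, Sym2.eq_swap (a := a)]
        refine hsym.abs_add_drift_le_of_commute hlam hf h2 (by rwa [← h.mid_eq]) fun hs => ?_
        refine hside s(a', b') ?_ rfl
        unfold IsFlip.IsSide at hs ⊢
        rw [Sym2.eq_swap (a := a) (b := c), Sym2.eq_swap (a := b) (b := c),
          Sym2.eq_swap (a := a) (b := d), Sym2.eq_swap (a := b) (b := d)]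
        tauto
      · push Not at h1 h2
        rw [drift_eq_zero h1, drift_eq_zero h2, add_zero, add_zero]
        exact hw

lemma IsFlip.sum_siteBound_le {σ τ : State m n η} {a b c d : ℤ × ℤ}
    (h : IsFlip σ.1 τ.1 a b c d) :
    ∑ y ∈ freeMidpoints m n η, siteBound a b c d y ≤
      5 ^ max (edgeLength s(a, b)) (edgeLength s(c, d)) *
        ((freeMidpoints m n η).card - 1 / 5) := by
  obtain ⟨hab, hac, hbc, had, hbd, hcd⟩ := h.ne_points σ.isTriangulation.subset
  set w : ℝ := 5 ^ max (edgeLength s(a, b)) (edgeLength s(c, d)) with hw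
  set F := freeMidpoints m n η with hF
  have hx : doubleMid s(a, b) ∈ F := h.mem_freeMidpoints
  have h1 : ∑ y ∈ F, (if y = doubleMid s(a, b) then 0 else w) = w * (F.card - 1) := by
    have : ∀ y ∈ F, (if y = doubleMid s(a, b) then 0 else w)
        = w - if y = doubleMid s(a, b) then w else 0 := by
      intro y _; split_ifs <;> ring
    rw [Finset.sum_congr rfl this, Finset.sum_sub_distrib, Finset.sum_ite_eq' F, if_pos hx,
      Finset.sum_const, nsmul_eq_mul]
    ring
  have h2 : ∀ (x : ℤ × ℤ) (k : ℕ), ∑ y ∈ F, (if y = x then (5 : ℝ) ^ k else 0) ≤ 5 ^ k := by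
    intro x k
    rw [Finset.sum_ite_eq' F]
    split_ifs
    · exact le_rfl
    · positivity
  -- with `U` and `V` the weights of the sides, `U V ≤ w` and `5 ≤ U, V`
  obtain ⟨U, hU⟩ : ∃ U : ℝ, U = 5 ^ edgeLength s(a, c) := ⟨_, rfl⟩
  obtain ⟨V, hV⟩ : ∃ V : ℝ, V = 5 ^ edgeLength s(a, d) := ⟨_, rfl⟩
  have hU5 : 5 ≤ U := by
    rw [hU]; exact le_self_pow₀ (by norm_num) (edgeLength_pos hac).ne'
  have hV5 : 5 ≤ V := by
    rw [hV]; exact le_self_pow₀ (by norm_num) (edgeLength_pos had).ne'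
  have hUV : U * V ≤ w := by
    rw [hU, hV, hw, ← pow_add]
    exact pow_le_pow_right₀ (by norm_num) h.add_le_max_edgeLength
  simp only [siteBound, Finset.sum_add_distrib]
  rw [← hw, h1]
  have k1 := h2 (doubleMid s(a, c)) (edgeLength s(a, c))
  have k2 := h2 (doubleMid s(b, c)) (edgeLength s(b, c))
  have k3 := h2 (doubleMid s(a, d)) (edgeLength s(a, d))
  have k4 := h2 (doubleMid s(b, d)) (edgeLength s(b, d))
  rw [h.edgeLength_bd] at *
  rw [h.edgeLength_bc] at *
  rw [← hU] at k1 k4 ⊢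
  rw [← hV] at k2 k3 ⊢
  nlinarith

/-- One step of the dynamics contracts the weighted Lipschitz constant. -/
lemma FlipLipschitz.glauber (hlam : 0 < lam) (hlam' : lam ≤ 1 / 8) {K M : ℝ} (hK : 0 ≤ K)
    (hM : ((freeMidpoints m n η).card : ℝ) ≤ M) {f : State m n η → ℝ} (hf : FlipLipschitz K f) :
    FlipLipschitz (K * (1 - 1 / (5 * M))) ((glauber m n η lam).mulVec f) := by
  intro σ τ a b c d h
  set F := freeMidpoints m n η with hF
  have hN : (0 : ℝ) < F.card := by
    exact_mod_cast Finset.card_pos.2 ⟨_, h.mem_freeMidpoints⟩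
  have key : (LatticeTriangulation.glauber m n η lam).mulVec f σ
      - (LatticeTriangulation.glauber m n η lam).mulVec f τ
      = (F.card : ℝ)⁻¹ * ∑ y ∈ F, (f σ + drift lam y f σ - (f τ + drift lam y f τ)) := by
    rw [glauber_mulVec hlam, glauber_mulVec hlam, Finset.sum_sub_distrib, Finset.sum_add_distrib,
      Finset.sum_add_distrib, Finset.sum_const, Finset.sum_const, nsmul_eq_mul, nsmul_eq_mul, ← hF]
    field_simp
  rw [key, abs_mul, abs_of_nonneg (by positivity)]
  calc (F.card : ℝ)⁻¹ * |∑ y ∈ F, (f σ + drift lam y f σ - (f τ + drift lam y f τ))|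
      ≤ (F.card : ℝ)⁻¹ * ∑ y ∈ F, K * siteBound a b c d y := by
        gcongr
        exact (Finset.abs_sum_le_sum_abs _ _).trans
          (Finset.sum_le_sum fun y _ => h.abs_add_drift_le hlam hlam' hK hf y)
    _ ≤ (F.card : ℝ)⁻¹ * (K * (5 ^ max (edgeLength s(a, b)) (edgeLength s(c, d)) *
          (F.card - 1 / 5))) := by
        rw [← Finset.mul_sum]
        gcongr
        exact h.sum_siteBound_le
    _ = K * (1 - 1 / (5 * F.card)) * 5 ^ max (edgeLength s(a, b)) (edgeLength s(c, d)) := by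
        field_simp
    _ ≤ _ := by gcongr

lemma FlipLipschitz.glauber_pow (hlam : 0 < lam) (hlam' : lam ≤ 1 / 8) {K M : ℝ} (hK : 0 ≤ K)
    (hM1 : 1 ≤ M) (hM : ((freeMidpoints m n η).card : ℝ) ≤ M) {f : State m n η → ℝ}
    (hf : FlipLipschitz K f) (t : ℕ) :
    FlipLipschitz (K * (1 - 1 / (5 * M)) ^ t)
      ((LatticeTriangulation.glauber m n η lam ^ t).mulVec f) := by
  have h0 : 0 ≤ 1 - 1 / (5 * M) := by
    rw [sub_nonneg, div_le_one (by positivity)]; linarith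
  induction t with
  | zero => simpa using hf
  | succ t ih =>
    rw [pow_succ' (LatticeTriangulation.glauber m n η lam), ← Matrix.mulVec_mulVec, pow_succ,
      ← mul_assoc]
    exact ih.glauber hlam hlam' (by positivity) hM

lemma FlipLipschitz.abs_sub_le {K : ℝ} (hK : 0 ≤ K) {f : State m n η → ℝ}
    (hf : FlipLipschitz K f) (σ τ : State m n η) :
    |f σ - f τ| ≤ flipBound m n * (K * 5 ^ (m + n)) := by
  have key : ∀ (k : ℕ) (σ' τ' : Finset (Sym2 (ℤ × ℤ))), FlipPath τ.1 k σ' τ' →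
      ∀ (h1 : σ' ∈ triangulations m n η) (h2 : τ' ∈ triangulations m n η),
      |f ⟨σ', h1⟩ - f ⟨τ', h2⟩| ≤ k * (K * 5 ^ (m + n)) := by
    intro k σ' τ' hp
    induction hp with
    | refl σ => intro h1 h2; simp
    | @head k σ₁ σ₂ σ₃ a b c d hflip hab _ ih =>
      intro h1 h3
      have h2 : σ₂ ∈ triangulations m n η :=
        hflip.mem_triangulations_of_notMem h1 fun h => hab (τ.subset h)
      have e1 := hf ⟨σ₁, h1⟩ ⟨σ₂, h2⟩ a b c d hflip
      have e2 := ih h2 h3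
      have hsub := (mem_triangulations.1 h1).1.subset
      have hlen : max (edgeLength s(a, b)) (edgeLength s(c, d)) ≤ m + n :=
        max_le (edgeLength_le (hsub hflip.mem)) (edgeLength_le (hflip.cd_mem_latticeEdges hsub))
      have e3 : K * 5 ^ max (edgeLength s(a, b)) (edgeLength s(c, d)) ≤ K * 5 ^ (m + n) := by
        gcongr
        norm_num
      push_cast
      calc _ ≤ |f ⟨σ₁, h1⟩ - f ⟨σ₂, h2⟩| + |f ⟨σ₂, h2⟩ - f ⟨σ₃, h3⟩| := _root_.abs_sub_le _ _ _
        _ ≤ _ := by linarith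
  obtain ⟨k, hk, hp⟩ := exists_flipPath σ.isTriangulation τ.isTriangulation
  refine (key k _ _ hp σ.2 τ.2).trans ?_
  gcongr

/-! ### Convergence to the Gibbs distribution -/

lemma moveProb_balance (σ τ : State m n η) :
    gibbs m n η lam σ * moveProb m n η lam σ τ = gibbs m n η lam τ * moveProb m n η lam τ σ := by
  classical
  have hsymm : ∀ x, FlipAt x σ.1 τ.1 → FlipAt x τ.1 σ.1 := by
    intro x hx
    obtain ⟨a, b, c, d, hx, h⟩ := (flipAt_iff σ.isTriangulation τ.isTriangulation).1 hx
    exact (flipAt_iff τ.isTriangulation σ.isTriangulation).2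
      ⟨c, d, b, a, h.mid_eq.symm.trans hx, h.symm σ.isTriangulation⟩
  have hsymm' : ∀ x, FlipAt x τ.1 σ.1 → FlipAt x σ.1 τ.1 := by
    intro x hx
    obtain ⟨a, b, c, d, hx, h⟩ := (flipAt_iff τ.isTriangulation σ.isTriangulation).1 hx
    exact (flipAt_iff σ.isTriangulation τ.isTriangulation).2
      ⟨c, d, b, a, h.mid_eq.symm.trans hx, h.symm τ.isTriangulation⟩
  rw [moveProb, moveProb, Finset.mul_sum, Finset.mul_sum]
  refine Finset.sum_congr rfl fun x _ => ?_
  by_cases hx : FlipAt x σ.1 τ.1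
  · rw [if_pos hx, if_pos (hsymm x hx), add_comm (gibbs m n η lam σ)]
    ring
  · rw [if_neg hx, if_neg fun h => hx (hsymm' x h)]
    ring

lemma glauber_balance (σ τ : State m n η) :
    gibbs m n η lam σ * glauber m n η lam σ τ = gibbs m n η lam τ * glauber m n η lam τ σ := by
  by_cases h : τ = σ
  · rw [h]
  · rw [glauber, glauber, if_neg h, if_neg (Ne.symm h), moveProb_balance]

lemma glauber_row_sum (hlam : 0 < lam) (σ : State m n η) : ∑ τ, glauber m n η lam σ τ = 1 := by
  have h := glauber_mulVec hlam (fun _ => 1) σ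
  simpa [Matrix.mulVec, dotProduct, drift] using h

lemma gibbs_sum_mulVec (hlam : 0 < lam) (f : State m n η → ℝ) :
    ∑ σ, gibbs m n η lam σ * (glauber m n η lam).mulVec f σ = ∑ σ, gibbs m n η lam σ * f σ := by
  simp only [Matrix.mulVec, dotProduct, Finset.mul_sum]
  rw [Finset.sum_comm]
  refine Finset.sum_congr rfl fun τ _ => ?_
  calc ∑ σ, gibbs m n η lam σ * (glauber m n η lam σ τ * f τ)
      = ∑ σ, gibbs m n η lam τ * f τ * glauber m n η lam τ σ := by
        refine Finset.sum_congr rfl fun σ _ => ?_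
        rw [← mul_assoc, glauber_balance]; ring
    _ = gibbs m n η lam τ * f τ := by rw [← Finset.mul_sum, glauber_row_sum hlam, mul_one]

lemma gibbs_sum_pow_mulVec (hlam : 0 < lam) (f : State m n η → ℝ) (t : ℕ) :
    ∑ σ, gibbs m n η lam σ * (glauber m n η lam ^ t).mulVec f σ
      = ∑ σ, gibbs m n η lam σ * f σ := by
  induction t with
  | zero => simp
  | succ t ih => rw [pow_succ', ← Matrix.mulVec_mulVec, gibbs_sum_mulVec hlam, ih]

lemma gibbs_nonneg (hlam : 0 < lam) (σ : State m n η) : 0 ≤ gibbs m n η lam σ :=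
  div_nonneg (by positivity) (Finset.sum_nonneg fun _ _ => by positivity)

lemma sum_gibbs (hlam : 0 < lam) (σ : State m n η) : ∑ τ, gibbs m n η lam τ = 1 := by
  have hZ : 0 < ∑ τ : State m n η, lam ^ totalLength τ.1 :=
    Finset.sum_pos (fun _ _ => by positivity) ⟨σ, Finset.mem_univ _⟩
  simp only [gibbs]
  rw [← Finset.sum_div, div_self hZ.ne']

/-- The total variation distance to equilibrium is at most the oscillation of the evolved test
functions with values in `[-1, 1]`. -/
lemma tvDist_le (hlam : 0 < lam) {B : ℝ} (t : ℕ)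
    (hB : ∀ f : State m n η → ℝ, (∀ σ, |f σ| ≤ 1) → ∀ σ τ,
      |(glauber m n η lam ^ t).mulVec f σ - (glauber m n η lam ^ t).mulVec f τ| ≤ 2 * B)
    (σ : State m n η) : tvDist ((glauber m n η lam ^ t) σ) (gibbs m n η lam) ≤ B := by
  set P := glauber m n η lam ^ t with hP
  set s : State m n η → ℝ := fun τ => SignType.sign (P σ τ - gibbs m n η lam τ) with hs
  have hs1 : ∀ τ, |s τ| ≤ 1 := by
    intro τ
    simp only [hs]
    rcases SignType.sign (P σ τ - gibbs m n η lam τ) with _ | _ | _ <;> simp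
  have h1 : ∑ τ, |P σ τ - gibbs m n η lam τ|
      = ∑ ρ, gibbs m n η lam ρ * (P.mulVec s σ - P.mulVec s ρ) := by
    have e1 : ∑ τ, |P σ τ - gibbs m n η lam τ|
        = P.mulVec s σ - ∑ τ, gibbs m n η lam τ * s τ := by
      rw [Matrix.mulVec, dotProduct, ← Finset.sum_sub_distrib]
      refine Finset.sum_congr rfl fun τ _ => ?_
      rw [← sub_mul, hs, self_mul_sign]
    rw [e1, ← gibbs_sum_pow_mulVec hlam s t]
    simp only [mul_sub, Finset.sum_sub_distrib]
    rw [← Finset.sum_mul, sum_gibbs hlam σ, one_mul]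
  have h2 : ∑ ρ, gibbs m n η lam ρ * (P.mulVec s σ - P.mulVec s ρ)
      ≤ ∑ ρ, gibbs m n η lam ρ * (2 * B) := by
    refine Finset.sum_le_sum fun ρ _ => ?_
    exact mul_le_mul_of_nonneg_left ((le_abs_self _).trans (hB s hs1 σ ρ)) (gibbs_nonneg hlam ρ)
  rw [← Finset.sum_mul, sum_gibbs hlam σ] at h2
  rw [tvDist, h1]
  linarith

lemma tvDist_glauber_pow_le (hlam : 0 < lam) (hlam' : lam ≤ 1 / 8) {M : ℝ} (hM1 : 1 ≤ M)
    (hM : ((freeMidpoints m n η).card : ℝ) ≤ M) (t : ℕ) (σ : State m n η) :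
    tvDist ((glauber m n η lam ^ t) σ) (gibbs m n η lam)
      ≤ flipBound m n * 5 ^ (m + n) * (1 - 1 / (5 * M)) ^ t := by
  refine tvDist_le hlam t (fun f hf => ?_) σ
  have hLip : FlipLipschitz 2 f := by
    intro σ τ a b c d _
    have h1 := abs_le.1 (hf σ)
    have h2 := abs_le.1 (hf τ)
    have h3 : (1 : ℝ) ≤ 5 ^ max (edgeLength s(a, b)) (edgeLength s(c, d)) :=
      one_le_pow₀ (by norm_num)
    rw [abs_le]
    constructor <;> linarith
  have h0 : 0 ≤ 1 - 1 / (5 * M) := by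
    rw [sub_nonneg, div_le_one (by positivity)]; linarith
  intro σ τ
  refine ((hLip.glauber_pow hlam hlam' (by norm_num) hM1 hM t).abs_sub_le (by positivity)
    σ τ).trans (le_of_eq ?_)
  ring

lemma card_freeMidpoints_le : (freeMidpoints m n η).card ≤ (2 * m + 1) * (2 * n + 1) := by
  refine (Finset.card_le_card (Finset.sdiff_subset.trans (Finset.filter_subset _ _))).trans ?_
  rw [Finset.card_product, Int.card_Icc, Int.card_Icc]
  exact le_of_eq (by congr 1)

/-- After `360 mn(m + n)` steps the exponential contraction has absorbed both the number of flips
between two states, a polynomial, and the largest weight `5 ^ (m + n)` of a flip. -/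
lemma flipBound_mul_pow_le (hm : 1 ≤ m) (hn : 1 ≤ n) :
    (flipBound m n : ℝ) * 5 ^ (m + n) *
      (1 - 1 / (5 * (9 * (m * n)))) ^ (360 * (m * n * (m + n))) ≤ 1 / 4 := by
  have hm' : (1 : ℝ) ≤ m := by exact_mod_cast hm
  have hn' : (1 : ℝ) ≤ n := by exact_mod_cast hn
  have hmn : (1 : ℝ) ≤ m * n := by nlinarith
  have h1 : (1 - 1 / (5 * (9 * ((m : ℝ) * n)))) ^ (360 * (m * n * (m + n)))
      ≤ Real.exp (-8) ^ (m + n) := by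
    calc _ ≤ Real.exp (-(1 / (5 * (9 * ((m : ℝ) * n))))) ^ (360 * (m * n * (m + n))) := by
          refine pow_le_pow_left₀ ?_ ?_ _
          · rw [sub_nonneg, div_le_one (by positivity)]; linarith
          · linarith [Real.add_one_le_exp (-(1 / (5 * (9 * ((m : ℝ) * n)))))]
      _ = Real.exp (-8) ^ (m + n) := by
          rw [← Real.exp_nat_mul, ← Real.exp_nat_mul]
          congr 1
          push_cast
          field_simp
          norm_num
  have h2 : (m : ℝ) * n ≤ 2 ^ (m + n) := by
    rw [pow_add]
    have e1 : (m : ℝ) ≤ 2 ^ m := by exact_mod_cast Nat.lt_two_pow_self.le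
    have e2 : (n : ℝ) ≤ 2 ^ n := by exact_mod_cast Nat.lt_two_pow_self.le
    gcongr
  have h3 : (flipBound m n : ℝ) ≤ 162 * 8 ^ (m + n) := by
    have e : (2 * (m : ℝ) + 1) * (2 * n + 1) ≤ 9 * (m * n) := by nlinarith
    calc (flipBound m n : ℝ) = ((2 * m + 1) * (2 * n + 1)) * ((2 * m + 1) * (2 * n + 1)) *
          (2 * (m * n)) := by
          simp only [flipBound, insertionBound]; push_cast; ring
      _ ≤ (9 * (m * n)) * (9 * (m * n)) * (2 * (m * n)) := by gcongr
      _ = 162 * ((m : ℝ) * n) ^ 3 := by ring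
      _ ≤ 162 * (2 ^ (m + n)) ^ 3 := by gcongr
      _ = 162 * 8 ^ (m + n) := by rw [← pow_mul, mul_comm (m + n), pow_mul]; norm_num
  have h4 : Real.exp (-8) ≤ 1 / 1100 := by
    have e : (2.7 : ℝ) ≤ Real.exp 1 := by linarith [Real.exp_one_gt_d9]
    have e' : (1100 : ℝ) ≤ Real.exp 8 := by
      calc (1100 : ℝ) ≤ 2.7 ^ 8 := by norm_num
        _ ≤ Real.exp 1 ^ 8 := by gcongr
        _ = Real.exp 8 := by rw [← Real.exp_nat_mul]; norm_num
    rw [Real.exp_neg, inv_eq_one_div]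
    gcongr
  calc _ ≤ 162 * 8 ^ (m + n) * 5 ^ (m + n) * (1 / 1100 : ℝ) ^ (m + n) := by
        have h5 : Real.exp (-8) ^ (m + n) ≤ (1 / 1100) ^ (m + n) := by gcongr
        refine mul_le_mul (by gcongr) (h1.trans h5) (pow_nonneg ?_ _) (by positivity)
        rw [sub_nonneg, div_le_one (by positivity)]
        linarith
    _ = 162 * (2 / 55 : ℝ) ^ (m + n) := by
        rw [mul_assoc, mul_assoc, ← mul_pow, ← mul_pow]; norm_num
    _ ≤ 162 * (2 / 55 : ℝ) ^ 2 := by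
        gcongr ?_ * ?_
        exact pow_le_pow_of_le_one (by norm_num) (by norm_num) (by omega)
    _ ≤ 1 / 4 := by norm_num

lemma mem_mixedTimes (hlam : 0 < lam) (hlam' : lam ≤ 1 / 8) :
    360 * (m * n * (m + n)) ∈ mixedTimes m n η lam := by
  intro σ
  rcases Nat.eq_zero_or_pos (m * n) with h | h
  · refine (tvDist_glauber_pow_le hlam hlam' (le_max_left 1 _) (le_max_right 1 _) _ σ).trans ?_
    have : flipBound m n = 0 := by simp [flipBound, insertionBound, h]
    rw [this]
    norm_num
  · have hm : 1 ≤ m := Nat.pos_of_mul_pos_right h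
    have hn : 1 ≤ n := Nat.pos_of_mul_pos_left h
    have hm' : (1 : ℝ) ≤ m := by exact_mod_cast hm
    have hn' : (1 : ℝ) ≤ n := by exact_mod_cast hn
    have hM : ((freeMidpoints m n η).card : ℝ) ≤ 9 * (m * n) := by
      have : ((freeMidpoints m n η).card : ℝ) ≤ (2 * m + 1) * (2 * n + 1) := by
        exact_mod_cast card_freeMidpoints_le
      nlinarith
    exact (tvDist_glauber_pow_le hlam hlam' (by nlinarith) hM _ σ).trans
      (flipBound_mul_pow_le hm hn)

end Dynamics

end LatticeTriangulation

theorem mainTheorem2 :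
    ∃ C : ℝ, 0 < C ∧ ∀ lam : ℝ, 0 < lam → lam ≤ 1 / 8 →
      ∀ (m n : ℕ) (η : Finset (Sym2 (ℤ × ℤ))), LatticeTriangulation.IsConstraintSet m n η →
        (LatticeTriangulation.mixedTimes m n η lam).Nonempty ∧
        (LatticeTriangulation.mixingTime m n η lam : ℝ) ≤
          C * ((m : ℝ) * (n : ℝ) * ((m : ℝ) + (n : ℝ))) := by
  refine ⟨360, by norm_num, fun lam h0 h1 m n η _ => ?_⟩
  have h := LatticeTriangulation.mem_mixedTimes (m := m) (n := n) (η := η) h0 h1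
  exact ⟨⟨_, h⟩, by exact_mod_cast Nat.sInf_le h⟩
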